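/- **Theorem (triangular generalized Lie bialgebroids).** Let $M$ be a smooth (finite-dimensional, Hausdorff, second countable) manifold without boundary and let $(A,[\cdot,\cdot],\rho)$ be a Lie algebroid over $M$, i.e. a smooth real vector bundle of finite rank with a Lie bracket on $\Gamma(A)$ and a smooth bundle map $\rho:A\to TM$ inducing a Lie algebra homomorphism $\Gamma(A)\to\mathfrak X(M)$ and satisfying $[X,fY]=f[X,Y]+(\rho(X)f)Y$. *Notation.* Let $d$ be the Lie algebroid differential, $$(d\alpha)(X_0,\dots,X_n)=\sum_{i}(-1)^i\rho(X_i)\,\alpha(X_0,\dots,\hat X_i,\dots,X_n)+\sum_{i<j}(-1)^{i+j}\alpha([X_i,X_j],X_0,\dots,\hat X_i,\dots,\hat X_j,\dots,X_n).$$ For $\phi\in\Gamma(A^*)$ put $d^{\phi}\alpha=d\alpha+\phi\wedge\alpha$ and, for $X\in\Gamma(A)$, $\mathcal L^{\phi}_X\alpha=d^{\phi}(\iota_X\alpha)+\iota_X(d^{\phi}\alpha)$; $\phi$ is a $1$-cocycle if $\phi([X,Y])=\rho(X)\phi(Y)-\rho(Y)\phi(X)$ for all $X,Y\in\Gamma(A)$.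 Let $[\cdot,\cdot]$ also denote the Schouten bracket on $\Gamma(\wedge^\bullet A)$, that is, the graded bracket with $[f,g]=0$ for functions, $[X,f]=\rho(X)f$, $[P,P']=-(-1)^{(r-1)(r'-1)}[P',P]$ and $[P,P'\wedge P'']=[P,P']\wedge P''+(-1)^{(r-1)r'}P'\wedge[P,P'']$, extending the bracket of $\Gamma(A)$; here and below $P,P'$ have degrees $r,r'$. With $(\iota_\phi P)(\alpha_2,\dots,\alpha_r)=P(\phi,\alpha_2,\dots,\alpha_r)$ (and $\iota_\phi f=0$ for functions), the $\phi$-deformed Schouten bracket is $$[P,P']^{\phi}=[P,P']+(r-1)\,P\wedge\iota_\phi P'-(-1)^{r-1}(r'-1)\,(\iota_\phi P)\wedge P',$$ and $\mathcal L^{\phi}_XP=[X,P]^{\phi}$ for $X\in\Gamma(A)$ and $P\in\Gamma(\wedge^\bullet A)$. If $A^*$ carries a Lie algebroid structure, the corresponding operators $d_*$, $d_*^{X}$, $\mathcal L^{X}_{*\alpha}$ ($X\in\Gamma(A)$, $\alpha\in\Gamma(A^*)$) act on $\Gamma(\wedge^\bullet A)$. *Statement.* Let $\phi_0\in\Gamma(A^*)$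 be a $1$-cocycle of $A$ and let $P\in\Gamma(\wedge^2A)$ satisfy $[P,P]^{\phi_0}=0$. Let $P^\sharp:A^*\to A$ be the bundle map with $\langle\beta,P^\sharp\alpha\rangle=P(\alpha,\beta)$. Then the bracket $$[\alpha,\beta]_*=\mathcal L^{\phi_0}_{P^\sharp\alpha}\beta-\mathcal L^{\phi_0}_{P^\sharp\beta}\alpha-d^{\phi_0}\big(P(\alpha,\beta)\big),\qquad \alpha,\beta\in\Gamma(A^*),$$ and the anchor $\rho_*=\rho\circ P^\sharp$ define a Lie algebroid structure on $A^*$. With this structure on $A^*$ and $X_0=-P^\sharp(\phi_0)$, the pair $((A,\phi_0),(A^*,X_0))$ is a generalized Lie bialgebroid; that is, $X_0$ is a $1$-cocycle of $A^*$, and $$d_*^{X_0}[X,Y]=[d_*^{X_0}X,Y]^{\phi_0}+[X,d_*^{X_0}Y]^{\phi_0}\qquad\text{for all }X,Y\in\Gamma(A),$$ $$\mathcal L^{X_0}_{*\phi_0}Q+\mathcal L^{\phi_0}_{X_0}Q=0\qquad\text{for all }Q\in\Gamma(\wedge^pA),\ p\ge 0.$$ -/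

import Mathlib

open scoped Manifold ContDiff
open Bundle

namespace GLB

set_option linter.unusedSectionVars false
set_option linter.unusedSimpArgs false

noncomputable section

/-- The algebraic data `(ρ, [·,·])` that a Lie algebroid induces on its `R`-module `Γ` of sections,
`R = C^∞(M)`: the sections act on `R` by derivations, and the bracket is skew and satisfies the
Leibniz rule. (The Jacobi identity and the compatibility of the anchor with brackets are part of
`LieAlgebroid` below; the operators of the calculus are defined without them.) -/
structure AnchoredBracket (R Γ : Type*) [CommRing R] [Algebra ℝ R] [AddCommGroup Γ] [Module ℝ Γ]
    [Module R Γ] where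
  anchor : Γ →ₗ[R] Derivation ℝ R R
  bracket : Γ →ₗ[ℝ] Γ →ₗ[ℝ] Γ
  bracket_self : ∀ X, bracket X X = 0
  leibniz : ∀ (X Y : Γ) (f : R), bracket X (f • Y) = f • bracket X Y + anchor X f • Y

/-- `k`-forms: alternating `R`-multilinear maps `Γ × ⋯ × Γ → R`. For `Γ = Γ(V)` and `R = C^∞(M)` these
are the sections of `⋀ᵏ V*`, and for `Γ = Γ(V*)` they are the sections of `⋀ᵏ V`. -/
abbrev Form (R Γ : Type*) [CommRing R] [AddCommGroup Γ] [Module R Γ] (k : ℕ) : Type _ :=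
  Γ [⋀^Fin k]→ₗ[R] R

section Forms
variable {R Γ : Type*} [CommRing R] [AddCommGroup Γ] [Module R Γ]

namespace Form

/-- A function as a form of degree `0`. -/
def ofFun (f : R) : Form R Γ 0 := AlternatingMap.constOfIsEmpty R Γ (Fin 0) f

/-- A linear functional as a form of degree `1`. -/
def ofDual (φ : Γ →ₗ[R] R) : Form R Γ 1 := AlternatingMap.ofSubsingleton R Γ R (0 : Fin 1) φ

/-- Transport along an equality of degrees. -/
def castDeg {k l : ℕ} (h : k = l) (α : Form R Γ k) : Form R Γ l := α.domDomCongr (finCongr h)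

/-- The contraction `(ι_X α)(X₂, …, X_k) = α(X, X₂, …, X_k)`; it is `0` in degree `0`. -/
def contract (X : Γ) : {k : ℕ} → Form R Γ k → Form R Γ (k - 1)
  | 0, _ => 0
  | _ + 1, α => α.curryLeft X

/-- The exterior product,
`(α ∧ β)(X₁, …, X_{k+l}) = ∑ sgn σ · α(X_{σ1}, …, X_{σk}) β(X_{σ(k+1)}, …, X_{σ(k+l)})`, the sum being
over the `(k, l)`-shuffles. -/
def wedge {k l : ℕ} (α : Form R Γ k) (β : Form R Γ l) : Form R Γ (k + l) :=
  ((LinearMap.mul' R R).compAlternatingMap (α.domCoprod β)).domDomCongr finSumFinEquiv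

/-- The exterior product `φ ∧ α` with a form `φ` of degree `1` on the left,
`(φ ∧ α)(X₀, …, X_k) = ∑ᵢ (-1)ⁱ φ(Xᵢ) α(X₀, …, X̂ᵢ, …, X_k)`. -/
def wedgeOne (φ : Γ →ₗ[R] R) {k : ℕ} (α : Form R Γ k) : Form R Γ (k + 1) :=
  AlternatingMap.alternatizeUncurryFin (φ.smulRight α)

theorem wedgeOne_apply (φ : Γ →ₗ[R] R) {k : ℕ} (α : Form R Γ k) (X : Fin (k + 1) → Γ) :
    wedgeOne φ α X = ∑ i : Fin (k + 1), (-1) ^ (i : ℕ) * (φ (X i) * α (i.removeNth X)) := by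
  simp [wedgeOne, AlternatingMap.alternatizeUncurryFin_apply]

end Form
end Forms

section Real
variable {R Γ : Type*} [CommRing R] [Algebra ℝ R] [AddCommGroup Γ] [Module ℝ Γ] [Module R Γ]

theorem alt_smul_of_smul_zero {k : ℕ} (a : Γ [⋀^Fin (k + 1)]→ₗ[ℝ] R)
    (h : ∀ (f : R) (v : Fin k → Γ) (x : Γ),
      a (Matrix.vecCons (f • x) v) = f * a (Matrix.vecCons x v))
    (v : Fin (k + 1) → Γ) (i : Fin (k + 1)) (f : R) (x : Γ) :
    a (Function.update v i (f • x)) = f * a (Function.update v i x) := by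
  have key : ∀ y : Γ, a (Function.update v i y)
      = (-1) ^ (i : ℕ) • a (Matrix.vecCons y (i.removeNth v)) := by
    intro y
    rw [← AlternatingMap.map_insertNth, Fin.insertNth_removeNth]
  rw [key, key, h]
  simp only [zsmul_eq_mul, Int.cast_pow, Int.cast_neg, Int.cast_one]
  ring

/-- An alternating `ℝ`-multilinear map into `R` that is `R`-homogeneous in its first slot is
`R`-multilinear. -/
def altOfReal {k : ℕ} (a : Γ [⋀^Fin (k + 1)]→ₗ[ℝ] R)
    (h : ∀ (f : R) (v : Fin k → Γ) (x : Γ),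
      a (Matrix.vecCons (f • x) v) = f * a (Matrix.vecCons x v)) :
    Form R Γ (k + 1) where
  toFun := a
  map_update_add' := by
    intro inst v i x y
    obtain rfl : inst = instDecidableEqFin _ := Subsingleton.elim _ _
    exact a.map_update_add v i x y
  map_update_smul' := by
    intro inst v i f x
    obtain rfl : inst = instDecidableEqFin _ := Subsingleton.elim _ _
    exact alt_smul_of_smul_zero a h v i f x
  map_eq_zero_of_eq' := a.map_eq_zero_of_eq'

variable [IsScalarTower ℝ R Γ]

/-- The underlying `ℝ`-multilinear form. -/
def Form.toReal {k : ℕ} (α : Form R Γ k) : Γ [⋀^Fin k]→ₗ[ℝ] R where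
  toMultilinearMap := α.toMultilinearMap.restrictScalars ℝ
  map_eq_zero_of_eq' := α.map_eq_zero_of_eq'

@[simp] theorem Form.toReal_apply {k : ℕ} (α : Form R Γ k) (v : Fin k → Γ) :
    α.toReal v = α v := rfl

namespace AnchoredBracket
variable (A : AnchoredBracket R Γ)

theorem bracket_swap (X Y : Γ) : A.bracket X Y = - A.bracket Y X := by
  have h := A.bracket_self (X + Y)
  simp only [map_add, LinearMap.add_apply, A.bracket_self] at h
  rw [eq_neg_iff_add_eq_zero]
  simpa [add_comm] using h

theorem bracket_smul_left (f : R) (X Y : Γ) :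
    A.bracket (f • X) Y = f • A.bracket X Y - A.anchor Y f • X := by
  rw [A.bracket_swap, A.leibniz, A.bracket_swap Y X]; simp; abel

/-- `∑ᵢ (-1)ⁱ ρ(Xᵢ) α(X₀, …, X̂ᵢ, …, Xₖ)` -/
def dAnchor {k : ℕ} (α : Form R Γ k) : Γ [⋀^Fin (k + 1)]→ₗ[ℝ] R :=
  AlternatingMap.alternatizeUncurryFin
    { toFun := fun X => ((A.anchor X : Derivation ℝ R R) : R →ₗ[ℝ] R).compAlternatingMap α.toReal
      map_add' := by intro X Y; ext v; simp
      map_smul' := by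
        intro c X; ext v
        have : c • X = algebraMap ℝ R c • X := (algebraMap_smul R c X).symm
        rw [this]
        simp [Algebra.smul_def] }

theorem dAnchor_apply {k : ℕ} (α : Form R Γ k) (X : Fin (k + 1) → Γ) :
    A.dAnchor α X = ∑ i : Fin (k + 1), (-1) ^ (i : ℕ) * A.anchor (X i) (α (i.removeNth X)) := by
  simp [dAnchor, AlternatingMap.alternatizeUncurryFin_apply]

/-- `(X, Y) ↦ α([X, Y], ·, …, ·)`. -/
def bracketInsert {k : ℕ} (α : Form R Γ (k + 1)) : Γ →ₗ[ℝ] Γ →ₗ[ℝ] Γ [⋀^Fin k]→ₗ[ℝ] R :=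
  A.bracket.compr₂ α.toReal.curryLeft

/-- `∑_{i<j} (-1)^{i+j} α([Xᵢ, Xⱼ], X₀, …, X̂ᵢ, …, X̂ⱼ, …, X_k)`, see `dBracket_apply`. -/
def dBracket : {k : ℕ} → Form R Γ k → Γ [⋀^Fin (k + 1)]→ₗ[ℝ] R
  | 0, _ => 0
  | _ + 1, α => (-(1 / 2) : ℝ) • AlternatingMap.alternatizeUncurryFin
      (AlternatingMap.alternatizeUncurryFinLM ∘ₗ A.bracketInsert α)

theorem dBracket_apply {k : ℕ} (α : Form R Γ (k + 1)) (X : Fin (k + 2) → Γ) :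
    A.dBracket α X = ∑ i : Fin (k + 1), ∑ j ≥ i, (-1) ^ ((i : ℕ) + (j + 1)) *
      α (Matrix.vecCons (A.bracket (X i.castSucc) (X j.succ))
        (j.removeNth <| i.castSucc.removeNth X)) := by
  rw [dBracket, AlternatingMap.smul_apply,
    AlternatingMap.alternatizeUncurryFin_alternatizeUncurryFinLM_comp_apply, Finset.smul_sum]
  refine Finset.sum_congr rfl fun i _ => ?_
  rw [Finset.smul_sum]
  refine Finset.sum_congr rfl fun j _ => ?_
  have e : A.bracketInsert α (X j.succ) (X i.castSucc)
      = - A.bracketInsert α (X i.castSucc) (X j.succ) := by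
    simp only [bracketInsert, LinearMap.compr₂_apply]
    rw [A.bracket_swap, map_neg]
  rw [e, AlternatingMap.neg_apply, sub_neg_eq_add, ← two_smul ℝ, smul_comm, smul_smul]
  simp only [bracketInsert, LinearMap.compr₂_apply, AlternatingMap.curryLeft_apply_apply,
    Form.toReal_apply, zsmul_eq_mul]
  norm_num [pow_add]

theorem dAnchor_smul {k : ℕ} (α : Form R Γ k) (f : R) (v : Fin k → Γ) (x : Γ) :
    A.dAnchor α (Matrix.vecCons (f • x) v) = f * A.dAnchor α (Matrix.vecCons x v)
      + ∑ i : Fin k, (-1) ^ ((i : ℕ) + 1) * (A.anchor (v i) f *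
        α (i.succ.removeNth (Matrix.vecCons x v))) := by
  have h0 : ∀ y : Γ, (0 : Fin (k + 1)).removeNth (Matrix.vecCons y v) = v := fun y => by
    funext j; simp [Fin.removeNth]
  cases k with
  | zero => simp [dAnchor_apply, h0]
  | succ k =>
    have h1 : ∀ (y : Γ) (i : Fin (k + 1)), i.succ.removeNth (Matrix.vecCons y v)
        = Matrix.vecCons y (i.removeNth v) := fun y i => by
      funext j
      refine Fin.cases ?_ (fun j => ?_) j <;> simp [Fin.removeNth, Matrix.vecCons]
    have h2 : ∀ i : Fin (k + 1), α (Matrix.vecCons (f • x) (i.removeNth v))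
        = f * α (Matrix.vecCons x (i.removeNth v)) := fun i => by
      exact congrArg (fun m => m (i.removeNth v)) (α.curryLeft.map_smul f x)
    simp only [dAnchor_apply, Fin.sum_univ_succ (n := k + 1), h0, h1, h2, Matrix.cons_val_zero,
      Matrix.cons_val_succ, mul_add, Finset.mul_sum, Derivation.leibniz, smul_eq_mul, map_smul,
      Derivation.smul_apply, Fin.val_succ, Fin.val_zero]
    rw [add_assoc, ← Finset.sum_add_distrib]
    congr 1
    · ring
    · refine Finset.sum_congr rfl fun i _ => by ring

theorem dBracket_smul {k : ℕ} (α : Form R Γ k) (f : R) (v : Fin k → Γ) (x : Γ) :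
    A.dBracket α (Matrix.vecCons (f • x) v) = f * A.dBracket α (Matrix.vecCons x v)
      - ∑ i : Fin k, (-1) ^ ((i : ℕ) + 1) * (A.anchor (v i) f *
        α (i.succ.removeNth (Matrix.vecCons x v))) := by
  cases k with
  | zero => simp [dBracket]
  | succ k =>
    have h0 : ∀ y : Γ, (0 : Fin (k + 2)).removeNth (Matrix.vecCons y v) = v := fun y => by
      funext j; simp [Fin.removeNth]
    have h1 : ∀ (y : Γ) (i : Fin (k + 1)), i.succ.removeNth (Matrix.vecCons y v)
        = Matrix.vecCons y (i.removeNth v) := fun y i => by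
      funext j
      refine Fin.cases ?_ (fun j => ?_) j <;> simp [Fin.removeNth, Matrix.vecCons]
    have hs : ∀ (g : R) (y : Γ) (w : Fin k → Γ), α (Matrix.vecCons (g • y) w)
        = g * α (Matrix.vecCons y w) := fun g y w =>
      congrArg (fun m => m w) (α.curryLeft.map_smul g y)
    have hsub : ∀ (y z : Γ) (w : Fin k → Γ), α (Matrix.vecCons (y - z) w)
        = α (Matrix.vecCons y w) - α (Matrix.vecCons z w) := fun y z w =>
      congrArg (fun m => m w) (α.curryLeft.map_sub y z)
    simp only [dBracket_apply]
    rw [Fin.sum_univ_succ, Fin.sum_univ_succ, mul_add]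
    have key : ∀ i : Fin k, ∑ j ≥ i.succ, (-1 : R) ^ (((i.succ : Fin (k + 1)) : ℕ) + (j + 1)) *
          α (Matrix.vecCons (A.bracket ((Matrix.vecCons (f • x) v : Fin (k + 2) → Γ) i.succ.castSucc)
            ((Matrix.vecCons (f • x) v : Fin (k + 2) → Γ) j.succ))
            (j.removeNth <| i.succ.castSucc.removeNth (Matrix.vecCons (f • x) v)))
        = f * ∑ j ≥ i.succ, (-1 : R) ^ (((i.succ : Fin (k + 1)) : ℕ) + (j + 1)) *
          α (Matrix.vecCons (A.bracket ((Matrix.vecCons x v : Fin (k + 2) → Γ) i.succ.castSucc)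
            ((Matrix.vecCons x v : Fin (k + 2) → Γ) j.succ))
            (j.removeNth <| i.succ.castSucc.removeNth (Matrix.vecCons x v))) := by
      intro i
      rw [Finset.mul_sum]
      refine Finset.sum_congr rfl fun j hj => ?_
      have hj' : i.succ ≤ j := by simpa using hj
      obtain ⟨j, rfl⟩ : ∃ j' : Fin k, j = j'.succ :=
        ⟨j.pred (by rintro rfl; simp at hj'), by simp⟩
      obtain _ | k := k
      · exact i.elim0
      have hk2 : ∀ y : Γ, (j.succ.removeNth <| i.succ.castSucc.removeNth (Matrix.vecCons y v))
          = Matrix.vecCons y (j.removeNth (i.castSucc.removeNth v)) := fun y => by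
        rw [← Fin.succ_castSucc, h1]
        funext l
        refine Fin.cases ?_ (fun l => ?_) l <;> simp [Fin.removeNth, Matrix.vecCons]
      have sw : ∀ (b y : Γ) (w : Fin k → Γ), α (Matrix.vecCons b (Matrix.vecCons y w))
          = - α (Matrix.vecCons y (Matrix.vecCons b w)) := fun b y w => by
        have := α.map_swap (Matrix.vecCons y (Matrix.vecCons b w))
          (show (0 : Fin (k + 2)) ≠ 1 by simp)
        rw [← this]
        congr 1
        funext l
        refine Fin.cases ?_ (fun l => ?_) l
        · simp
        refine Fin.cases ?_ (fun l => ?_) l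
        · simp
        · have e : Equiv.swap (0 : Fin (k + 2)) 1 l.succ.succ = l.succ.succ :=
            Equiv.swap_apply_of_ne_of_ne (Fin.succ_ne_zero _) (by
              intro h
              exact (Fin.succ_ne_zero l) (Fin.succ_injective _ h))
          simp [e]
      rw [hk2, hk2]
      have c1 : ∀ y : Γ, (Matrix.vecCons y v : Fin (k + 1 + 2) → Γ) i.succ.castSucc
          = v i.castSucc := fun y => by
        rw [← Fin.succ_castSucc]; simp
      have c2 : ∀ y : Γ, (Matrix.vecCons y v : Fin (k + 1 + 2) → Γ) j.succ.succ
          = v j.succ := fun y => by simp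
      rw [c1, c1, c2, c2, sw, hs, sw]
      ring
    rw [Finset.sum_congr rfl fun i _ => key i, ← Finset.mul_sum, add_sub_right_comm]
    congr 1
    have e2 : Finset.Ici (0 : Fin (k + 1)) = Finset.univ := by ext; simp
    rw [e2, Finset.mul_sum, ← Finset.sum_sub_distrib]
    refine Finset.sum_congr rfl fun j _ => ?_
    simp only [Fin.castSucc_zero, h0, Matrix.cons_val_zero, Matrix.cons_val_succ, h1,
      A.bracket_smul_left, hs, hsub, Fin.val_zero, zero_add]
    ring

/-- The Lie algebroid differential,
`(dα)(X₀, …, X_k) = ∑ᵢ (-1)ⁱ ρ(Xᵢ) α(X₀, …, X̂ᵢ, …, X_k)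
  + ∑_{i<j} (-1)^{i+j} α([Xᵢ, Xⱼ], X₀, …, X̂ᵢ, …, X̂ⱼ, …, X_k)`, see `d_apply`. -/
def d {k : ℕ} (α : Form R Γ k) : Form R Γ (k + 1) :=
  altOfReal (A.dAnchor α + A.dBracket α) fun f v x => by
    simp only [AlternatingMap.add_apply, dAnchor_smul, dBracket_smul]
    ring

/-- The pairs `i < j` of indices are written `(i.castSucc, j.succ)` with `i ≤ j`. -/
theorem d_apply {k : ℕ} (α : Form R Γ (k + 1)) (X : Fin (k + 2) → Γ) :
    A.d α X = ∑ i : Fin (k + 2), (-1) ^ (i : ℕ) * A.anchor (X i) (α (i.removeNth X))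
      + ∑ i : Fin (k + 1), ∑ j ≥ i, (-1) ^ ((i : ℕ) + (j + 1)) *
        α (Matrix.vecCons (A.bracket (X i.castSucc) (X j.succ))
          (j.removeNth <| i.castSucc.removeNth X)) := by
  rw [← dAnchor_apply, ← dBracket_apply]; rfl

theorem d_apply_zero (α : Form R Γ 0) (X : Fin 1 → Γ) :
    A.d α X = A.anchor (X 0) (α Fin.elim0) := by
  have h : A.d α X = A.dAnchor α X := by simp [d, altOfReal, dBracket]
  rw [h, dAnchor_apply]
  simp
  congr 2
  exact Subsingleton.elim _ _

/-- `φ` is a `1`-cocycle: `φ([X, Y]) = ρ(X) φ(Y) - ρ(Y) φ(X)`. -/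
def IsCocycle (A : AnchoredBracket R Γ) (φ : Γ →ₗ[R] R) : Prop :=
  ∀ X Y : Γ, φ (A.bracket X Y) = A.anchor X (φ Y) - A.anchor Y (φ X)

/-- The `φ`-deformed differential `d^φ α = dα + φ ∧ α`. -/
def dTwist (φ : Γ →ₗ[R] R) {k : ℕ} (α : Form R Γ k) : Form R Γ (k + 1) :=
  A.d α + Form.wedgeOne φ α

/-- The `φ`-deformed Lie derivative `L^φ_X α = d^φ(ι_X α) + ι_X(d^φ α)` (the first term is absent in
degree `0`). -/
def lieTwist (φ : Γ →ₗ[R] R) (X : Γ) : {k : ℕ} → Form R Γ k → Form R Γ k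
  | 0, α => Form.contract X (A.dTwist φ α)
  | k + 1, α => (A.dTwist φ (Form.contract X α : Form R Γ k) : Form R Γ (k + 1)) +
      (show Form R Γ (k + 1) from Form.contract X (A.dTwist φ α))

end AnchoredBracket
end Real

section Multisections
variable {R Γ D : Type*} [CommRing R] [Algebra ℝ R] [AddCommGroup Γ] [Module ℝ Γ] [Module R Γ]
  [IsScalarTower ℝ R Γ] [AddCommGroup D] [Module ℝ D] [Module R D] [IsScalarTower ℝ R D]
  (e : Γ ≃ₗ[R] Module.Dual R D)

/-- The functional `β ↦ P(β, J₁, …, J_p)`. -/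
def evalRest {p : ℕ} (P : Form R D (p + 1)) (J : Fin p → D) : Module.Dual R D where
  toFun β := P (Matrix.vecCons β J)
  map_add' β γ := congrArg (fun m => m J) (P.curryLeft.map_add β γ)
  map_smul' f β := congrArg (fun m => m J) (P.curryLeft.map_smul f β)

/-- For `P` of degree `p + 1`, the section `P(·, J₁, …, J_p) ∈ Γ`, i.e. the section `X` of `A` with
`⟨β, X⟩ = P(β, J₁, …, J_p)` for all `β`. -/
def insertRest {p : ℕ} (P : Form R D (p + 1)) : D [⋀^Fin p]→ₗ[R] Γ where
  toFun J := e.symm (evalRest P J)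
  map_update_add' J i x y := by
    rw [← map_add]
    congr 1
    ext β
    exact (P.curryLeft β).map_update_add J i x y
  map_update_smul' J i f x := by
    rw [← map_smul]
    congr 1
    ext β
    exact (P.curryLeft β).map_update_smul J i f x
  map_eq_zero_of_eq' J i j h hij := by
    have : evalRest P J = 0 := by
      ext β
      exact (P.curryLeft β).map_eq_zero_of_eq J h hij
    rw [this, map_zero]

theorem pair_insertRest {p : ℕ} (P : Form R D (p + 1)) (J : Fin p → D) (β : D) :
    e (insertRest e P J) β = P (Matrix.vecCons β J) := by
  change e (e.symm (evalRest P J)) β = _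
  rw [e.apply_symm_apply]; rfl

namespace AnchoredBracket
variable (A : AnchoredBracket R Γ)

/-- With `X = P(·, α₁, …, α_p)` and `Y = Q(·, α_{p+1}, …, α_{p+q})`, the expression
`⟨α₀, [X, Y]⟩ - q/(q+1) · ρ(X)⟨α₀, Y⟩ + p/(p+1) · ρ(Y)⟨α₀, X⟩`. -/
def schoutenTerm {p q : ℕ} (P : Form R D (p + 1)) (Q : Form R D (q + 1))
    (α : Fin (p + q + 1) → D) : R :=
  let α₀ : D := α 0
  let X : Γ := insertRest e P fun j => α (Fin.castAdd q j).succ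
  let Y : Γ := insertRest e Q fun i => α (Fin.natAdd p i).succ
  e (A.bracket X Y) α₀ - ((q : ℝ) / (q + 1)) • A.anchor X (e Y α₀)
    + ((p : ℝ) / (p + 1)) • A.anchor Y (e X α₀)

theorem real_smul_eq {N : Type*} [AddCommGroup N] [Module ℝ N] [Module R N] [IsScalarTower ℝ R N]
    (c : ℝ) (x : N) : c • x = algebraMap ℝ R c • x := (algebraMap_smul R c x).symm

theorem e_smul (c : ℝ) (X : Γ) (β : D) : e (c • X) β = c • e X β := by
  rw [real_smul_eq (R := R) c X, map_smul, LinearMap.smul_apply, algebraMap_smul]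

theorem e_smul' (c : ℝ) (X : Γ) (β : D) : e X (c • β) = c • e X β := by
  rw [real_smul_eq (R := R) c β, map_smul, algebraMap_smul]

theorem anchor_smul (c : ℝ) (X : Γ) (f : R) : A.anchor (c • X) f = c • A.anchor X f := by
  rw [real_smul_eq (R := R) c X, map_smul, Derivation.smul_apply, algebraMap_smul]

theorem insertRest_smul {p : ℕ} (P : Form R D (p + 1)) (J : Fin p → D) (i : Fin p) (c : ℝ) (x : D) :
    insertRest e P (Function.update J i (c • x)) = c • insertRest e P (Function.update J i x) := by
  rw [real_smul_eq (R := R) c x, AlternatingMap.map_update_smul, ← real_smul_eq]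

theorem update_zero_succ {n m : ℕ} (α : Fin (n + 1) → D) (x : D) (s : Fin m → Fin n) :
    (fun j => Function.update α 0 x (s j).succ) = fun j => α (s j).succ := by
  funext j; simp [Fin.succ_ne_zero]

theorem update_succ_left {p q : ℕ} (α : Fin (p + q + 1) → D) (x : D) (i : Fin p) :
    (fun j => Function.update α (Fin.castAdd q i).succ x (Fin.castAdd q j).succ)
      = Function.update (fun j => α (Fin.castAdd q j).succ) i x := by
  funext j
  simp [Function.update_apply, Fin.castAdd_inj]

theorem update_succ_left' {p q : ℕ} (α : Fin (p + q + 1) → D) (x : D) (i : Fin p) :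
    (fun j => Function.update α (Fin.castAdd q i).succ x (Fin.natAdd p j).succ)
      = fun j => α (Fin.natAdd p j).succ := by
  funext j
  rw [Function.update_of_ne]
  intro h
  have := congrArg Fin.val h
  simp at this
  omega

theorem update_succ_right {p q : ℕ} (α : Fin (p + q + 1) → D) (x : D) (i : Fin q) :
    (fun j => Function.update α (Fin.natAdd p i).succ x (Fin.natAdd p j).succ)
      = Function.update (fun j => α (Fin.natAdd p j).succ) i x := by
  funext j
  simp [Function.update_apply]

theorem update_succ_right' {p q : ℕ} (α : Fin (p + q + 1) → D) (x : D) (i : Fin q) :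
    (fun j => Function.update α (Fin.natAdd p i).succ x (Fin.castAdd q j).succ)
      = fun j => α (Fin.castAdd q j).succ := by
  funext j
  rw [Function.update_of_ne]
  intro h
  have := congrArg Fin.val h
  simp at this
  omega

theorem update_succ_zero {n : ℕ} (α : Fin (n + 1) → D) (x : D) (i : Fin n) :
    Function.update α i.succ x 0 = α 0 := by
  rw [Function.update_of_ne (Fin.succ_ne_zero i).symm]

/-- `schoutenTerm` as an `ℝ`-multilinear map. -/
def schoutenMulti {p q : ℕ} (P : Form R D (p + 1)) (Q : Form R D (q + 1)) :
    MultilinearMap ℝ (fun _ : Fin (p + q + 1) => D) R where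
  toFun := A.schoutenTerm e P Q
  map_update_add' := by
    intro inst α i x y
    obtain rfl : inst = instDecidableEqFin _ := Subsingleton.elim _ _
    refine Fin.cases ?_ (fun i => ?_) i
    · simp [schoutenTerm]; abel
    · refine Fin.addCases (fun i => ?_) (fun i => ?_) i
      · simp only [schoutenTerm, update_succ_left, update_succ_left', update_succ_zero,
          AlternatingMap.map_update_add, map_add, LinearMap.add_apply, Derivation.add_apply,
          smul_add]
        abel
      · simp only [schoutenTerm, update_succ_right, update_succ_right', update_succ_zero,
          AlternatingMap.map_update_add, map_add, LinearMap.add_apply, Derivation.add_apply,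
          smul_add]
        abel
  map_update_smul' := by
    intro inst α i c x
    obtain rfl : inst = instDecidableEqFin _ := Subsingleton.elim _ _
    refine Fin.cases ?_ (fun i => ?_) i
    · simp only [schoutenTerm, update_zero_succ, Function.update_self, e_smul', map_smul, smul_add,
        smul_sub, Derivation.map_smul]
      simp only [smul_comm c]
    · refine Fin.addCases (fun i => ?_) (fun i => ?_) i
      · simp only [schoutenTerm, update_succ_left, update_succ_left', update_succ_zero,
          insertRest_smul, map_smul, LinearMap.smul_apply, e_smul, anchor_smul, smul_add,
          smul_sub, Derivation.map_smul]
        simp only [smul_comm c]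
      · simp only [schoutenTerm, update_succ_right, update_succ_right', update_succ_zero,
          insertRest_smul, map_smul, LinearMap.smul_apply, e_smul, anchor_smul, smul_add,
          smul_sub, Derivation.map_smul]
        simp only [smul_comm c]

theorem sum_perm_eq_zero {n : ℕ} (G : (Fin (n + 1) → D) → R) (c : Fin (n + 1) → ℝ)
    (hG : ∀ i : Fin n, c i.succ ≠ 0 → ∀ γ : Fin (n + 1) → D,
      G (fun l => γ (Equiv.swap 0 i.succ l)) = - G γ)
    (hc : ∑ k, c k = 0) (β : Fin (n + 1) → D) :
    ∑ σ : Equiv.Perm (Fin (n + 1)), Equiv.Perm.sign σ • (c (σ.symm 0) • G fun l => β (σ l)) = 0 := by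
  classical
  set W : R := ∑ σ : Equiv.Perm (Fin (n + 1)),
    if σ.symm 0 = 0 then Equiv.Perm.sign σ • G (fun l => β (σ l)) else 0 with hW
  have h1 : ∀ k : Fin (n + 1), c k • (∑ σ : Equiv.Perm (Fin (n + 1)),
      if σ.symm 0 = k then Equiv.Perm.sign σ • G (fun l => β (σ l)) else 0) = c k • W := by
    intro k
    refine Fin.cases rfl (fun i => ?_) k
    by_cases h0 : c i.succ = 0
    · simp [h0]
    congr 1
    rw [hW, ← Equiv.sum_comp (Equiv.mulRight (Equiv.swap (0 : Fin (n + 1)) i.succ))]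
    refine Finset.sum_congr rfl fun σ _ => ?_
    have e1 : ((σ * Equiv.swap (0 : Fin (n + 1)) i.succ).symm 0 = i.succ) ↔ σ.symm 0 = 0 := by
      rw [Equiv.symm_apply_eq, Equiv.symm_apply_eq, Equiv.Perm.mul_apply, Equiv.swap_apply_right]
    simp only [Equiv.coe_mulRight, e1]
    split_ifs with h
    · have := hG i h0 (fun l => β (σ l))
      simp only [Equiv.Perm.mul_apply]
      rw [this, Equiv.Perm.sign_mul, Equiv.Perm.sign_swap (Fin.succ_ne_zero i).symm]
      simp
    · rfl
  have h2 : ∀ σ : Equiv.Perm (Fin (n + 1)),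
      Equiv.Perm.sign σ • (c (σ.symm 0) • G fun l => β (σ l))
      = ∑ k, c k • (if σ.symm 0 = k then Equiv.Perm.sign σ • G (fun l => β (σ l)) else 0) := by
    intro σ
    rw [Finset.sum_eq_single (σ.symm 0)]
    · rw [if_pos rfl]; exact smul_comm _ _ _
    · intro k _ hk
      simp [hk.symm]
    · simp
  simp_rw [h2]
  rw [Finset.sum_comm]
  simp_rw [← Finset.smul_sum]
  rw [Finset.sum_congr rfl fun k _ => h1 k, ← Finset.sum_smul, hc, zero_smul]

/-- `P(·, α₁, …, α_p)`. -/
def restLeft {p : ℕ} (q : ℕ) (P : Form R D (p + 1)) (α : Fin (p + q + 1) → D) : Γ :=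
  insertRest e P fun j => α (Fin.castAdd q j).succ

/-- `Q(·, α_{p+1}, …, α_{p+q})`. -/
def restRight (p : ℕ) {q : ℕ} (Q : Form R D (q + 1)) (α : Fin (p + q + 1) → D) : Γ :=
  insertRest e Q fun i => α (Fin.natAdd p i).succ

theorem swap_fix {n : ℕ} (i l : Fin n) (h : l ≠ i) :
    Equiv.swap (0 : Fin (n + 1)) i.succ l.succ = l.succ :=
  Equiv.swap_apply_of_ne_of_ne (Fin.succ_ne_zero l) (fun h' => h (Fin.succ_injective _ h'))

theorem pair_swap {p : ℕ} (P : Form R D (p + 1)) (i : Fin p) (β : D) (J : Fin p → D) :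
    P (Matrix.vecCons (J i) (Function.update J i β)) = - P (Matrix.vecCons β J) := by
  rw [← P.map_swap (Matrix.vecCons β J) (Fin.succ_ne_zero i).symm]
  congr 1
  funext l
  refine Fin.cases ?_ (fun l => ?_) l
  · simp
  · by_cases h : l = i
    · subst h; simp
    · simp [h, swap_fix _ _ h]

theorem restLeft_swap {p q : ℕ} (P : Form R D (p + 1)) (γ : Fin (p + q + 1) → D) (i : Fin p) :
    e (restLeft e q P fun l => γ (Equiv.swap 0 (Fin.castAdd q i).succ l)) (γ (Fin.castAdd q i).succ)
      = - e (restLeft e q P γ) (γ 0) := by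
  rw [restLeft, restLeft, pair_insertRest, pair_insertRest,
    ← pair_swap P i (γ 0) (fun j => γ (Fin.castAdd q j).succ)]
  congr 2
  funext l
  by_cases h : l = i
  · subst h; simp
  · rw [Function.update_of_ne h, swap_fix]
    intro h'; exact h (Fin.castAdd_injective _ _ h')

theorem restRight_swap {p q : ℕ} (Q : Form R D (q + 1)) (γ : Fin (p + q + 1) → D) (i : Fin q) :
    e (restRight e p Q fun l => γ (Equiv.swap 0 (Fin.natAdd p i).succ l)) (γ (Fin.natAdd p i).succ)
      = - e (restRight e p Q γ) (γ 0) := by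
  rw [restRight, restRight, pair_insertRest, pair_insertRest,
    ← pair_swap Q i (γ 0) (fun j => γ (Fin.natAdd p j).succ)]
  congr 2
  funext l
  by_cases h : l = i
  · subst h; simp
  · rw [Function.update_of_ne h, swap_fix]
    intro h'; exact h (Fin.natAdd_injective _ _ h')

theorem castAdd_ne_natAdd {p q : ℕ} (i : Fin p) (j : Fin q) :
    Fin.castAdd q i ≠ Fin.natAdd p j := by
  intro h
  have := congrArg Fin.val h
  simp at this
  omega

theorem restLeft_swap' {p q : ℕ} (P : Form R D (p + 1)) (γ : Fin (p + q + 1) → D) (i : Fin q) :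
    (restLeft e q P fun l => γ (Equiv.swap 0 (Fin.natAdd p i).succ l)) = restLeft e q P γ := by
  unfold restLeft
  congr 1
  funext j
  exact congrArg γ (swap_fix _ _ (castAdd_ne_natAdd j i))

theorem restRight_swap' {p q : ℕ} (Q : Form R D (q + 1)) (γ : Fin (p + q + 1) → D) (i : Fin p) :
    (restRight e p Q fun l => γ (Equiv.swap 0 (Fin.castAdd q i).succ l)) = restRight e p Q γ := by
  unfold restRight
  congr 1
  funext j
  exact congrArg γ (swap_fix _ _ (castAdd_ne_natAdd i j).symm)

/-- Coefficients occurring in `schoutenTerm_smul`. -/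
def coefL (p q : ℕ) : Fin (p + q + 1) → ℝ :=
  Fin.cons (-((q : ℝ) / (q + 1))) (Fin.append (fun _ : Fin p => 0) fun _ : Fin q => 1 / ((q : ℝ) + 1))

/-- Coefficients occurring in `schoutenTerm_smul`. -/
def coefR (p q : ℕ) : Fin (p + q + 1) → ℝ :=
  Fin.cons ((p : ℝ) / (p + 1)) (Fin.append (fun _ : Fin p => -(1 / ((p : ℝ) + 1))) fun _ : Fin q => 0)

theorem schoutenTerm_smul {p q : ℕ} (P : Form R D (p + 1)) (Q : Form R D (q + 1))
    (γ : Fin (p + q + 1) → D) (k : Fin (p + q + 1)) (f : R) :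
    A.schoutenTerm e P Q (Function.update γ k (f • γ k)) = f * A.schoutenTerm e P Q γ
      + coefL p q k • (A.anchor (restLeft e q P γ) f * e (restRight e p Q γ) (γ 0))
      + coefR p q k • (A.anchor (restRight e p Q γ) f * e (restLeft e q P γ) (γ 0)) := by
  have hp : (p : ℝ) / (p + 1) = 1 - 1 / (p + 1) := by field_simp; ring
  have hq : (q : ℝ) / (q + 1) = 1 - 1 / (q + 1) := by field_simp; ring
  refine Fin.cases ?_ (fun i => ?_) k
  · simp only [schoutenTerm, update_zero_succ, Function.update_self, coefL, coefR, Fin.cons_zero,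
      map_smul, smul_eq_mul, Derivation.leibniz, restLeft, restRight]
    simp only [Algebra.smul_def, map_neg]
    ring
  · refine Fin.addCases (fun i => ?_) (fun i => ?_) i
    · simp only [schoutenTerm, update_succ_left, update_succ_left', update_succ_zero,
        AlternatingMap.map_update_smul, Function.update_eq_self, coefL, coefR, Fin.cons_succ,
        Fin.append_left, map_smul, smul_eq_mul, Derivation.leibniz, restLeft, restRight,
        bracket_smul_left, map_sub, LinearMap.sub_apply, LinearMap.smul_apply,
        Derivation.smul_apply, hp]
      simp only [Algebra.smul_def, map_neg, map_sub, map_one, map_zero]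
      ring
    · simp only [schoutenTerm, update_succ_right, update_succ_right', update_succ_zero,
        AlternatingMap.map_update_smul, Function.update_eq_self, coefL, coefR, Fin.cons_succ,
        Fin.append_right, map_smul, smul_eq_mul, Derivation.leibniz, restLeft, restRight,
        A.leibniz, map_add, LinearMap.add_apply, LinearMap.smul_apply,
        Derivation.smul_apply, hq]
      simp only [Algebra.smul_def, map_neg, map_sub, map_one, map_zero]
      ring

theorem schouten_homogeneous {p q : ℕ} (P : Form R D (p + 1)) (Q : Form R D (q + 1))
    (f : R) (v : Fin (p + q) → D) (x : D) :
    MultilinearMap.alternatization (A.schoutenMulti e P Q) (Matrix.vecCons (f • x) v)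
      = f * MultilinearMap.alternatization (A.schoutenMulti e P Q) (Matrix.vecCons x v) := by
  set β : Fin (p + q + 1) → D := Matrix.vecCons x v with hβ
  have hup : ∀ σ : Equiv.Perm (Fin (p + q + 1)),
      (fun l => (Matrix.vecCons (f • x) v : Fin (p + q + 1) → D) (σ l))
        = Function.update (fun l => β (σ l)) (σ.symm 0) (f • β (σ (σ.symm 0))) := by
    intro σ
    funext l
    by_cases h : l = σ.symm 0
    · subst h; simp [hβ]
    · rw [Function.update_of_ne h]
      have h' : σ l ≠ 0 := fun h' => h ((Equiv.symm_apply_eq σ).2 h'.symm).symm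
      obtain ⟨m, hm⟩ := Fin.exists_succ_eq.2 h'
      rw [← hm]; simp [hβ]
  have hT : ∀ γ, A.schoutenMulti e P Q γ = A.schoutenTerm e P Q γ := fun _ => rfl
  have zL := sum_perm_eq_zero
    (fun γ => A.anchor (restLeft e q P γ) f * e (restRight e p Q γ) (γ 0)) (coefL p q)
    (by
      intro i
      refine Fin.addCases (fun i => ?_) (fun i => ?_) i
      · intro h; exact absurd (by simp [coefL]) h
      · intro _ γ
        simp only [restLeft_swap', Equiv.swap_apply_left, restRight_swap, mul_neg])
    (by
      simp [coefL, Fin.sum_univ_succ, Fin.sum_univ_add]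
      field_simp; ring) β
  have zR := sum_perm_eq_zero
    (fun γ => A.anchor (restRight e p Q γ) f * e (restLeft e q P γ) (γ 0)) (coefR p q)
    (by
      intro i
      refine Fin.addCases (fun i => ?_) (fun i => ?_) i
      · intro _ γ
        simp only [restRight_swap', Equiv.swap_apply_left, restLeft_swap, mul_neg]
      · intro h; exact absurd (by simp [coefR]) h)
    (by
      simp [coefR, Fin.sum_univ_succ, Fin.sum_univ_add]
      field_simp; ring) β
  simp only [MultilinearMap.alternatization_apply, smul_apply,
    MultilinearMap.domDomCongr_apply, hT, hup]
  simp only [schoutenTerm_smul, smul_add, Finset.sum_add_distrib]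
  rw [zL, zR, add_zero, add_zero, Finset.mul_sum]
  exact Finset.sum_congr rfl fun σ _ => (mul_smul_comm _ _ _).symm

/-- The Schouten bracket of multisections `P`, `Q` of positive degrees `p + 1`, `q + 1`:
`[P, Q](α₀, …, α_{p+q}) = 1/(p! q!) ∑_σ sgn σ · T(α_{σ0}, …, α_{σ(p+q)})`, with `T` the expression
`schoutenTerm`. On products of sections it gives
`[X₁∧⋯∧X_m, Y₁∧⋯∧Y_n] = ∑_{i,j} (-1)^{i+j} [Xᵢ, Yⱼ] ∧ X₁∧⋯X̂ᵢ⋯∧X_m ∧ Y₁∧⋯Ŷⱼ⋯∧Y_n`: the first term of `T`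
yields this up to derivatives of the coefficients `⟨α, Xᵢ⟩`, `⟨α, Yⱼ⟩` along the anchor, and the two
other terms of `T` cancel those. -/
def schoutenPos {p q : ℕ} (P : Form R D (p + 1)) (Q : Form R D (q + 1)) : Form R D (p + q + 1) :=
  altOfReal ((1 / ((p.factorial : ℝ) * q.factorial)) •
      MultilinearMap.alternatization (A.schoutenMulti e P Q)) fun f v x => by
    rw [AlternatingMap.smul_apply, AlternatingMap.smul_apply, schouten_homogeneous, mul_smul_comm]

theorem schoutenPos_apply {p q : ℕ} (P : Form R D (p + 1)) (Q : Form R D (q + 1))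
    (α : Fin (p + q + 1) → D) :
    A.schoutenPos e P Q α = (1 / ((p.factorial : ℝ) * q.factorial)) •
      ∑ σ : Equiv.Perm (Fin (p + q + 1)), Equiv.Perm.sign σ •
        A.schoutenTerm e P Q (fun l => α (σ l)) := by
  change (1 / ((p.factorial : ℝ) * q.factorial)) •
      MultilinearMap.alternatization (A.schoutenMulti e P Q) α = _
  rw [MultilinearMap.alternatization_apply]; rfl

/-- The contraction `ι_{df} P`, i.e. `(ι_{df} P)(J) = ρ(P(·, J)) f`. -/
def contractDiff {p : ℕ} (f : R) (P : Form R D (p + 1)) : Form R D p :=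
  ({ toFun := fun X => A.anchor X f
     map_add' := fun X Y => by simp
     map_smul' := fun g X => by simp } : Γ →ₗ[R] R).compAlternatingMap (insertRest e P)

/-- The Schouten bracket `[P, Q]` on multisections of all degrees: the bracket with
`[f, g] = 0`, `[X, f] = ρ(X) f`, `[X, Y]` the bracket of sections,
`[P, Q] = -(-1)^{(p-1)(q-1)} [Q, P]` and
`[P, Q ∧ Q'] = [P, Q] ∧ Q' + (-1)^{(p-1)q} Q ∧ [P, Q']`. If one of the arguments is a function it is
`[P, f] = (-1)^{p-1} ι_{df} P` and `[f, Q] = -ι_{df} Q`. -/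
def schouten : {p q : ℕ} → Form R D p → Form R D q → Form R D (p + q - 1)
  | 0, 0, _, _ => 0
  | 0, q + 1, f, Q => Form.castDeg (by omega) (- A.contractDiff e (f Fin.elim0) Q)
  | p + 1, 0, P, f => ((-1 : ℤ) ^ p • A.contractDiff e (f Fin.elim0) P : Form R D p)
  | p + 1, q + 1, P, Q => Form.castDeg (by omega) (A.schoutenPos e P Q)

/-- `P ∧ ι_φ Q`. -/
def wedgeContract (φ : D) {p : ℕ} (P : Form R D p) : {q : ℕ} → Form R D q → Form R D (p + q - 1)
  | 0, _ => 0
  | _ + 1, Q => (Form.wedge P (Q.curryLeft φ))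

/-- `(ι_φ P) ∧ Q`. -/
def contractWedge (φ : D) : {p q : ℕ} → Form R D p → Form R D q → Form R D (p + q - 1)
  | 0, _, _, _ => 0
  | _ + 1, _, P, Q => Form.castDeg (by omega) (Form.wedge (P.curryLeft φ) Q)

/-- The `φ`-deformed Schouten bracket, for `P` of degree `p` and `Q` of degree `q`,
`[P, Q]^φ = [P, Q] + (p - 1) P ∧ ι_φ Q - (-1)^{p-1} (q - 1) (ι_φ P) ∧ Q`. -/
def schoutenTwist (φ : D) {p q : ℕ} (P : Form R D p) (Q : Form R D q) : Form R D (p + q - 1) :=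
  A.schouten e P Q + ((p : ℤ) - 1) • wedgeContract φ P Q
    - ((-1) ^ (p + 1) * ((q : ℤ) - 1)) • contractWedge φ P Q

end AnchoredBracket
end Multisections

section Bundles
variable (E : Type*) [NormedAddCommGroup E] [NormedSpace ℝ E]
  (M : Type*) [TopologicalSpace M] [ChartedSpace E M]

/-- The algebra `C^∞(M)`. -/
abbrev SmoothFun : Type _ := C^∞⟮𝓘(ℝ, E), M; 𝓘(ℝ, ℝ), ℝ⟯

variable (F : Type*) [NormedAddCommGroup F] [NormedSpace ℝ F] (V : M → Type*)
  [TopologicalSpace (TotalSpace F V)] [∀ x, TopologicalSpace (V x)] [FiberBundle F V]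
  [∀ x, AddCommGroup (V x)] [∀ x, Module ℝ (V x)] [VectorBundle ℝ F V]

/-- The space `Γ(V)` of smooth sections. -/
abbrev SmoothSection : Type _ := Cₛ^∞⟮𝓘(ℝ, E); F, V⟯

/-- The dual bundle `V*`, with model fibre `F →L[ℝ] ℝ`. -/
abbrev DualBundle : M → Type _ := fun x => V x →L[ℝ] Bundle.Trivial M ℝ x

/-- Smooth vector fields on `M`. -/
abbrev VectorField [IsManifold 𝓘(ℝ, E) ∞ M] : Type _ :=
  SmoothSection E M E fun x : M => TangentSpace 𝓘(ℝ, E) x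

variable {E M F V}

/-- `Γ(V)` as a module over `C^∞(M)`. -/
instance instSMulSmoothSection : SMul (SmoothFun E M) (SmoothSection E M F V) :=
  ⟨fun f s => ⟨fun x => f x • s x, f.contMDiff.smul_section s.contMDiff⟩⟩

theorem smul_section_apply (f : SmoothFun E M) (s : SmoothSection E M F V) (x : M) :
    (f • s) x = f x • s x := rfl

instance instModuleSmoothSection : Module (SmoothFun E M) (SmoothSection E M F V) where
  one_smul s := by ext x; exact one_smul ℝ (s x)
  mul_smul f g s := by ext x; exact mul_smul (f x) (g x) (s x)
  smul_zero f := by ext x; exact smul_zero (f x)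
  smul_add f s t := by ext x; exact smul_add (f x) (s x) (t x)
  add_smul f g s := by ext x; exact add_smul (f x) (g x) (s x)
  zero_smul s := by ext x; exact zero_smul ℝ (s x)

instance instIsScalarTowerSmoothSection : IsScalarTower ℝ (SmoothFun E M) (SmoothSection E M F V) where
  smul_assoc c f s := by ext x; exact smul_assoc c (f x) (s x)

theorem sum_smul_section_apply {ι : Type*} [Fintype ι] (f : ι → SmoothFun E M)
    (s : ι → SmoothSection E M F V) (x : M) :
    (∑ i, f i • s i : SmoothSection E M F V) x = ∑ i, f i x • s i x := by
  have := congrFun (map_sum (ContMDiffSection.coeAddHom 𝓘(ℝ, E) F ∞ V)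
    (fun i => f i • s i) Finset.univ) x
  rw [Finset.sum_apply] at this
  exact this

theorem contMDiff_of_trivial_section {g : M → ℝ}
    (h : ContMDiff 𝓘(ℝ, E) (𝓘(ℝ, E).prod 𝓘(ℝ, ℝ)) ∞
      (fun x => (⟨x, g x⟩ : TotalSpace ℝ (Bundle.Trivial M ℝ)))) :
    ContMDiff 𝓘(ℝ, E) 𝓘(ℝ, ℝ) ∞ g := by
  intro x
  simpa using! (contMDiffAt_totalSpace.1 (h x)).2

/-- The pairing `⟨α, X⟩ ∈ C^∞(M)`. -/
def pairing (α : SmoothSection E M (F →L[ℝ] ℝ) (DualBundle M V)) (X : SmoothSection E M F V) :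
    SmoothFun E M :=
  ⟨fun x => α x (X x), contMDiff_of_trivial_section (α.contMDiff.clm_bundle_apply X.contMDiff)⟩

section Field
variable [IsManifold 𝓘(ℝ, E) ∞ M]

/-- The derivation `f ↦ v f` of `C^∞(M)` defined by a vector field `v`. -/
def VectorField.deriv (v : VectorField E M) :
    Derivation ℝ (SmoothFun E M) (SmoothFun E M) :=
  Derivation.mk'
    { toFun := fun f => ⟨fun x => mfderiv 𝓘(ℝ, E) 𝓘(ℝ, ℝ) f x (v x), by
        have h := (f.contMDiff.contMDiff_tangentMap (m := ∞) (by simp)).comp v.contMDiff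
        intro x
        simpa using! (contMDiffAt_totalSpace.1 (h x)).2⟩
      map_add' := fun f g => by
        ext x
        exact congrArg (fun L => L (v x)) (mfderiv_add
          (f.contMDiff.mdifferentiable (by simp) x) (g.contMDiff.mdifferentiable (by simp) x))
      map_smul' := fun c f => by
        ext x
        exact congrArg (fun L => L (v x)) (const_smul_mfderiv
          (f.contMDiff.mdifferentiable (by simp) x) c) }
    fun f g => by
      ext x
      exact congrArg (fun L => L (v x)) (HasMFDerivAt.mul
          (f.contMDiff.mdifferentiable (by simp) x).hasMFDerivAt
          (g.contMDiff.mdifferentiable (by simp) x).hasMFDerivAt).mfderiv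

end Field

section Extension
variable [FiniteDimensional ℝ E] [T2Space M] [IsManifold 𝓘(ℝ, E) ∞ M]

theorem exists_bump {x : M} {u : Set M} (hu : u ∈ nhds x) :
    ∃ χ : SmoothFun E M, (∀ᶠ y in nhds x, χ y = 1) ∧ tsupport χ ⊆ u := by
  obtain ⟨f, hf, -⟩ := (SmoothBumpFunction.nhds_basis_support (I := 𝓘(ℝ, E)) hu).mem_iff.1 hu
  exact ⟨⟨f, f.contMDiff⟩, f.eventuallyEq_one, hf⟩

theorem exists_extend_fun {x : M} {u : Set M} (hu : IsOpen u) (hx : x ∈ u) {g : M → ℝ}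
    (hg : ContMDiffOn 𝓘(ℝ, E) 𝓘(ℝ, ℝ) ∞ g u) :
    ∃ f : SmoothFun E M, ∀ᶠ y in nhds x, f y = g y := by
  obtain ⟨χ, h1, h2⟩ := exists_bump (E := E) (hu.mem_nhds hx)
  refine ⟨⟨fun y => χ y * g y, contMDiff_of_tsupport fun y hy => ?_⟩, ?_⟩
  · have hy' : y ∈ u := h2 (closure_mono (Function.support_mul_subset_left _ _) hy)
    exact χ.contMDiff.contMDiffAt.mul (hg.contMDiffAt (hu.mem_nhds hy'))
  · filter_upwards [h1] with y hy
    change χ y * g y = g y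
    rw [hy, one_mul]

theorem exists_extend_section {x : M} {u : Set M} (hu : IsOpen u) (hx : x ∈ u) {s : ∀ y, V y}
    (hs : ContMDiffOn 𝓘(ℝ, E) (𝓘(ℝ, E).prod 𝓘(ℝ, F)) ∞
      (fun y => (⟨y, s y⟩ : TotalSpace F V)) u) :
    ∃ t : SmoothSection E M F V, ∀ᶠ y in nhds x, t y = s y := by
  obtain ⟨χ, h1, h2⟩ := exists_bump (E := E) (hu.mem_nhds hx)
  refine ⟨⟨fun y => χ y • s y,
    ContMDiffOn.smul_section_of_tsupport χ.contMDiff.contMDiffOn hu h2 hs⟩, ?_⟩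
  filter_upwards [h1] with y hy
  change χ y • s y = s y
  rw [hy, one_smul]

variable [ContMDiffVectorBundle ∞ F V 𝓘(ℝ, E)]

theorem exists_constant_section (x : M) (w : F) :
    ∃ t : SmoothSection E M F V, ∀ᶠ y in nhds x, t y = (trivializationAt F V x).symm y w := by
  refine exists_extend_section (trivializationAt F V x).open_baseSet
    (FiberBundle.mem_baseSet_trivializationAt' x) ?_
  rw [Bundle.Trivialization.contMDiffOn_section_baseSet_iff]
  refine (contMDiffOn_const (c := w)).congr fun y hy => ?_
  rw [(trivializationAt F V x).apply_mk_symm hy]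

theorem dual_local (ℓ : SmoothSection E M F V →ₗ[SmoothFun E M] SmoothFun E M)
    {s : SmoothSection E M F V} {x : M} (h : ∀ᶠ y in nhds x, s y = 0) : ℓ s x = 0 := by
  obtain ⟨χ, h1, h2⟩ := exists_bump (E := E) h
  have h0 : χ • s = 0 := by
    ext y
    rw [smul_section_apply]
    by_cases hy : y ∈ tsupport χ
    · rw [show s y = 0 from h2 hy, smul_zero]; rfl
    · rw [image_eq_zero_of_notMem_tsupport hy, zero_smul]; rfl
  have h3 : (χ • ℓ s) x = 0 := by rw [← map_smul, h0, map_zero]; rfl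
  have h4 : χ x * ℓ s x = 0 := h3
  rwa [h1.self_of_nhds, one_mul] at h4

variable [FiniteDimensional ℝ F]

theorem dual_pointwise (ℓ : SmoothSection E M F V →ₗ[SmoothFun E M] SmoothFun E M)
    {s : SmoothSection E M F V} {x : M} (h : s x = 0) : ℓ s x = 0 := by
  let b := Module.finBasis ℝ F
  let t := trivializationAt F V x
  have hx : x ∈ t.baseSet := FiberBundle.mem_baseSet_trivializationAt' x
  choose σ hσ using fun i => exists_constant_section (E := E) (F := F) (V := V) x (b i)
  have hc : ∀ i, ∃ f : SmoothFun E M, ∀ᶠ y in nhds x, f y = b.repr (t ⟨y, s y⟩).2 i := by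
    intro i
    refine exists_extend_fun t.open_baseSet hx ?_
    have h1 := (Bundle.Trivialization.contMDiffOn_section_baseSet_iff t).1
      (s.contMDiff.contMDiffOn (s := t.baseSet))
    exact ((LinearMap.toContinuousLinearMap (b.coord i)).contMDiff).comp_contMDiffOn h1
  choose c hc using hc
  have hd : ∀ᶠ y in nhds x, (s - ∑ i, c i • σ i) y = 0 := by
    filter_upwards [t.open_baseSet.mem_nhds hx, Filter.eventually_all.2 hσ,
      Filter.eventually_all.2 hc] with y hy h1 h2
    change s y - (∑ i, c i • σ i : SmoothSection E M F V) y = 0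
    rw [sum_smul_section_apply, sub_eq_zero]
    simp only [h1, h2]
    have e2 : s y = t.symmₗ ℝ y (t ⟨y, s y⟩).2 := by
      rw [t.symmₗ_apply hy]
      exact (t.symm_apply_apply_mk hy (s y)).symm
    conv_lhs => rw [e2, ← b.sum_repr (t ⟨y, s y⟩).2, map_sum]
    refine Finset.sum_congr rfl fun i _ => ?_
    rw [map_smul, t.symmₗ_apply hy]
  have h3 := dual_local ℓ hd
  have hcx : ∀ i, c i x = 0 := fun i => by
    rw [(hc i).self_of_nhds, h]
    have : t ⟨x, (0 : V x)⟩ = (x, 0) := t.zeroSection ℝ hx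
    rw [this]; simp
  rw [map_sub, map_sum] at h3
  have h4 : ℓ s x = (∑ i, ℓ (c i • σ i) : SmoothFun E M) x := sub_eq_zero.1 h3
  have h5 : (∑ i, ℓ (c i • σ i) : SmoothFun E M) x = ∑ i, c i x * ℓ (σ i) x := by
    have := map_sum (ContMDiffMap.evalRingHom (I := 𝓘(ℝ, E)) (I' := 𝓘(ℝ, ℝ)) (n := ∞) x)
      (fun i => ℓ (c i • σ i)) Finset.univ
    simp only [map_smul] at this ⊢
    exact this
  rw [h4, h5]
  simp [hcx]

theorem dual_symm_apply {x y : M} (hy : y ∈ (trivializationAt F V x).baseSet) (g : F →L[ℝ] ℝ)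
    (v : V y) :
    (trivializationAt (F →L[ℝ] ℝ) (DualBundle M V) x).symm y g v
      = g ((trivializationAt F V x) ⟨y, v⟩).2 := by
  set tD := trivializationAt (F →L[ℝ] ℝ) (DualBundle M V) x
  set t := trivializationAt F V x
  have hyD : y ∈ tD.baseSet := ⟨hy, by simp⟩
  have h := tD.apply_mk_symm hyD g
  have h2 : ContinuousLinearMap.inCoordinates F V ℝ (Bundle.Trivial M ℝ) x y x y
      (tD.symm y g) = g := congrArg Prod.snd h
  have h3 := congrArg (fun L : F →L[ℝ] ℝ => L (t ⟨y, v⟩).2) h2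
  rw [← h3]
  have h4 : t.symmL ℝ y (t ⟨y, v⟩).2 = v := by
    rw [t.symmL_apply hy]; exact t.symm_apply_apply_mk hy v
  simp only [ContinuousLinearMap.inCoordinates, ContinuousLinearMap.comp_apply]
  change _ = (trivializationAt ℝ (Bundle.Trivial M ℝ) x).continuousLinearMapAt ℝ y
    (tD.symm y g (t.symmL ℝ y (t ⟨y, v⟩).2))
  rw [h4, Bundle.Trivialization.continuousLinearMapAt_apply,
    Bundle.Trivialization.coe_linearMapAt_of_mem _ (by simp)]
  rfl

theorem eq_of_sections {x : M} {v w : V x}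
    (h : ∀ α : SmoothSection E M (F →L[ℝ] ℝ) (DualBundle M V), α x v = α x w) : v = w := by
  suffices hξ : ∀ ξ : V x →L[ℝ] ℝ, ξ v = ξ w by
    let L := VectorBundle.continuousLinearEquivAt ℝ F V x
    apply L.injective
    by_contra hne
    obtain ⟨g, hg⟩ := SeparatingDual.exists_ne_zero (R := ℝ) (sub_ne_zero.2 hne)
    apply hg
    rw [map_sub, sub_eq_zero]
    exact hξ (g.comp (L : V x →L[ℝ] F))
  intro ξ
  let tD := trivializationAt (F →L[ℝ] ℝ) (DualBundle M V) x
  obtain ⟨α, hα⟩ := exists_constant_section (E := E) (F := F →L[ℝ] ℝ) (V := DualBundle M V) x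
    (tD ⟨x, ξ⟩).2
  have := hα.self_of_nhds
  rw [tD.symm_apply_apply_mk (FiberBundle.mem_baseSet_trivializationAt' x)] at this
  rw [← this]
  exact h α

theorem exists_frame (x : M) :
    ∃ (σ : Fin (Module.finrank ℝ F) → SmoothSection E M (F →L[ℝ] ℝ) (DualBundle M V))
      (s : Fin (Module.finrank ℝ F) → SmoothSection E M F V),
      ∀ᶠ y in nhds x, ∀ v : V y, v = ∑ i, σ i y v • s i y := by
  let b := Module.finBasis ℝ F
  let t := trivializationAt F V x
  choose s hs using fun i => exists_constant_section (E := E) (F := F) (V := V) x (b i)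
  choose σ hσ using fun i => exists_constant_section (E := E) (F := F →L[ℝ] ℝ)
    (V := DualBundle M V) x (LinearMap.toContinuousLinearMap (b.coord i))
  refine ⟨σ, s, ?_⟩
  filter_upwards [t.open_baseSet.mem_nhds (FiberBundle.mem_baseSet_trivializationAt' x),
    Filter.eventually_all.2 hs, Filter.eventually_all.2 hσ] with y hy h1 h2 v
  have e2 : v = t.symmₗ ℝ y (t ⟨y, v⟩).2 := by
    rw [t.symmₗ_apply hy]
    exact (t.symm_apply_apply_mk hy v).symm
  conv_lhs => rw [e2, ← b.sum_repr (t ⟨y, v⟩).2, map_sum]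
  refine Finset.sum_congr rfl fun i _ => ?_
  rw [map_smul, t.symmₗ_apply hy, h1, h2, dual_symm_apply hy]
  rfl

theorem frame_eval
    (ℓ : SmoothSection E M (F →L[ℝ] ℝ) (DualBundle M V) →ₗ[SmoothFun E M] SmoothFun E M) {y : M}
    {σ : Fin (Module.finrank ℝ F) → SmoothSection E M (F →L[ℝ] ℝ) (DualBundle M V)}
    {s : Fin (Module.finrank ℝ F) → SmoothSection E M F V}
    (h : ∀ v : V y, v = ∑ i, σ i y v • s i y)
    (α : SmoothSection E M (F →L[ℝ] ℝ) (DualBundle M V)) :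
    α y (∑ i, ℓ (σ i) y • s i y) = ℓ α y := by
  have h1 : (α - ∑ i, pairing α (s i) • σ i) y = 0 := by
    change α y - (∑ i, pairing α (s i) • σ i : SmoothSection E M (F →L[ℝ] ℝ) (DualBundle M V)) y = 0
    rw [sum_smul_section_apply, sub_eq_zero]
    ext v
    conv_lhs => rw [h v, map_sum]
    rw [sum_apply]
    refine Finset.sum_congr rfl fun i _ => ?_
    rw [map_smul]
    exact mul_comm _ _
  have h3 := dual_pointwise ℓ h1
  rw [map_sub, map_sum] at h3
  have h4 : ℓ α y = (∑ i, ℓ (pairing α (s i) • σ i) : SmoothFun E M) y := sub_eq_zero.1 h3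
  have h5 : (∑ i, ℓ (pairing α (s i) • σ i) : SmoothFun E M) y
      = ∑ i, pairing α (s i) y * ℓ (σ i) y := by
    have := map_sum (ContMDiffMap.evalRingHom (I := 𝓘(ℝ, E)) (I' := 𝓘(ℝ, ℝ)) (n := ∞) y)
      (fun i => ℓ (pairing α (s i) • σ i)) Finset.univ
    simp only [map_smul] at this ⊢
    exact this
  rw [h4, h5, map_sum]
  refine Finset.sum_congr rfl fun i _ => ?_
  rw [map_smul]
  exact mul_comm _ _

theorem exists_represent
    (ℓ : SmoothSection E M (F →L[ℝ] ℝ) (DualBundle M V) →ₗ[SmoothFun E M] SmoothFun E M) :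
    ∃ X : SmoothSection E M F V, ∀ α, pairing α X = ℓ α := by
  choose σ s h using exists_frame (E := E) (M := M) (F := F) (V := V)
  let X : ∀ x, V x := fun x => ∑ i, ℓ (σ x i) x • s x i x
  have hX : ∀ x α, α x (X x) = ℓ α x := fun x α => frame_eval ℓ (h x).self_of_nhds α
  refine ⟨⟨X, fun x => ?_⟩, fun α => by ext x; exact hX x α⟩
  refine ((∑ i, ℓ (σ x i) • s x i : SmoothSection E M F V).contMDiff x).congr_of_eventuallyEq ?_
  filter_upwards [h x] with y hy
  congr 1
  refine eq_of_sections (E := E) (F := F) fun α => ?_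
  rw [hX, sum_smul_section_apply, frame_eval ℓ hy α]

/-- `Γ(V) → Hom(Γ(V*), C^∞(M))`, `X ↦ ⟨·, X⟩`. -/
def dualMap : SmoothSection E M F V →ₗ[SmoothFun E M]
    Module.Dual (SmoothFun E M) (SmoothSection E M (F →L[ℝ] ℝ) (DualBundle M V)) where
  toFun X :=
    { toFun := fun α => pairing α X
      map_add' := fun _ _ => ContMDiffMap.ext fun _ => rfl
      map_smul' := fun _ _ => ContMDiffMap.ext fun _ => rfl }
  map_add' X Y := LinearMap.ext fun α => ContMDiffMap.ext fun x => map_add (α x) (X x) (Y x)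
  map_smul' f X := LinearMap.ext fun α => ContMDiffMap.ext fun x => map_smul (α x) (f x) (X x)

/-- The isomorphism `Γ(V) ≃ Hom(Γ(V*), C^∞(M))`, `X ↦ ⟨·, X⟩`. -/
def dualEquiv : SmoothSection E M F V ≃ₗ[SmoothFun E M]
    Module.Dual (SmoothFun E M) (SmoothSection E M (F →L[ℝ] ℝ) (DualBundle M V)) :=
  LinearEquiv.ofBijective dualMap
    ⟨fun _ _ h => ContMDiffSection.ext fun x => eq_of_sections (E := E) (F := F) fun α =>
        congrArg (fun g : SmoothFun E M => g x) (LinearMap.congr_fun h α),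
    fun ℓ => (exists_represent ℓ).imp fun _ hX => LinearMap.ext hX⟩

theorem dualEquiv_apply (X : SmoothSection E M F V)
    (α : SmoothSection E M (F →L[ℝ] ℝ) (DualBundle M V)) :
    dualEquiv X α = pairing α X := rfl

end Extension
end Bundles

section Algebroids
variable (E : Type*) [NormedAddCommGroup E] [NormedSpace ℝ E]
  (M : Type*) [TopologicalSpace M] [ChartedSpace E M] [IsManifold 𝓘(ℝ, E) ∞ M]
  (F : Type*) [NormedAddCommGroup F] [NormedSpace ℝ F] (V : M → Type*)
  [TopologicalSpace (TotalSpace F V)] [∀ x, TopologicalSpace (V x)] [FiberBundle F V]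
  [∀ x, AddCommGroup (V x)] [∀ x, Module ℝ (V x)] [VectorBundle ℝ F V]

/-- A Lie algebroid structure on the vector bundle `V → M` (with model fibre `F`): a smooth bundle
map `ρ : V → TM` and a Lie bracket on `Γ(V)` such that `ρ` is a Lie algebra homomorphism on sections
and `[X, f Y] = f [X, Y] + (ρ(X) f) Y`. -/
structure LieAlgebroid where
  /-- The anchor, a smooth section of `Hom(V, TM)`. -/
  anchor : SmoothSection E M (F →L[ℝ] E) (fun x => V x →L[ℝ] TangentSpace 𝓘(ℝ, E) x)
  /-- The bracket of sections. -/
  bracket : SmoothSection E M F V →ₗ[ℝ] SmoothSection E M F V →ₗ[ℝ] SmoothSection E M F V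
  bracket_self : ∀ X, bracket X X = 0
  jacobi : ∀ X Y Z,
    bracket X (bracket Y Z) + bracket Y (bracket Z X) + bracket Z (bracket X Y) = 0
  anchor_bracket : ∀ (X Y : SmoothSection E M F V) (x : M), anchor x (bracket X Y x) =
    VectorField.mlieBracket 𝓘(ℝ, E) (fun y => anchor y (X y)) (fun y => anchor y (Y y)) x
  leibniz : ∀ (X Y : SmoothSection E M F V) (f : SmoothFun E M), bracket X (f • Y) =
    f • bracket X Y + VectorField.deriv ⟨fun x => anchor x (X x),
      anchor.contMDiff.clm_bundle_apply X.contMDiff⟩ f • Y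

/-- Sections of `⋀ᵖ V`, viewed as alternating `C^∞(M)`-multilinear maps on `Γ(V*)`. -/
abbrev Multisection (p : ℕ) : Type _ :=
  Form (SmoothFun E M) (SmoothSection E M (F →L[ℝ] ℝ) (DualBundle M V)) p

variable {E M F V}

/-- The vector field `ρ(X)`. -/
def LieAlgebroid.anchorField (A : LieAlgebroid E M F V) (X : SmoothSection E M F V) :
    VectorField E M :=
  ⟨fun x => A.anchor x (X x), A.anchor.contMDiff.clm_bundle_apply X.contMDiff⟩

/-- The induced structure on the `C^∞(M)`-module of sections. -/
def LieAlgebroid.sections (A : LieAlgebroid E M F V) :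
    AnchoredBracket (SmoothFun E M) (SmoothSection E M F V) where
  anchor :=
    { toFun := fun X => (A.anchorField X).deriv
      map_add' := fun X Y => Derivation.ext fun f => ContMDiffMap.ext fun x => by
        change mfderiv 𝓘(ℝ, E) 𝓘(ℝ, ℝ) f x (A.anchor x (X x + Y x)) = _
        rw [map_add, map_add]; rfl
      map_smul' := fun g X => Derivation.ext fun f => ContMDiffMap.ext fun x => by
        change mfderiv 𝓘(ℝ, E) 𝓘(ℝ, ℝ) f x (A.anchor x (g x • X x)) = _
        rw [map_smul, map_smul]; rfl }
  bracket := A.bracket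
  bracket_self := A.bracket_self
  leibniz := A.leibniz

variable [FiniteDimensional ℝ E] [T2Space M] [FiniteDimensional ℝ F]
  [ContMDiffVectorBundle ∞ F V 𝓘(ℝ, E)]

/-- A section `X` of `V` as a multisection of degree `1`, `α ↦ ⟨α, X⟩`. -/
def sectionMulti (X : SmoothSection E M F V) : Multisection E M F V 1 :=
  Form.ofDual (dualEquiv X)

/-- A section `α` of `V*` as a functional on `Γ(V)`, `X ↦ ⟨α, X⟩`. -/
def covectorDual (α : SmoothSection E M (F →L[ℝ] ℝ) (DualBundle M V)) :
    SmoothSection E M F V →ₗ[SmoothFun E M] SmoothFun E M :=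
  (dualEquiv (E := E) (M := M) (F := F) (V := V)).toLinearMap.flip α

/-- The map `P^♯ : Γ(V*) → Γ(V)` of a multisection `P` of degree `2`,
determined by `⟨β, P^♯ α⟩ = P(α, β)`. -/
def sharp (P : Multisection E M F V 2) (α : SmoothSection E M (F →L[ℝ] ℝ) (DualBundle M V)) :
    SmoothSection E M F V :=
  dualEquiv.symm ((AlternatingMap.ofSubsingleton _ _ _ (0 : Fin 1)).symm (P.curryLeft α))

theorem pairing_sharp (P : Multisection E M F V 2)
    (α β : SmoothSection E M (F →L[ℝ] ℝ) (DualBundle M V)) :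
    pairing β (sharp P α) = P ![α, β] := by
  rw [← dualEquiv_apply, sharp, LinearEquiv.apply_symm_apply]
  change P.curryLeft α _ = _
  rw [AlternatingMap.curryLeft_apply_apply]
  congr 1
  funext i
  fin_cases i <;> rfl

namespace LieAlgebroid

/-- The `φ`-deformed Schouten bracket of multisections of a Lie algebroid. -/
def schoutenTwist (A : LieAlgebroid E M F V)
    (φ : SmoothSection E M (F →L[ℝ] ℝ) (DualBundle M V)) {p q : ℕ}
    (P : Multisection E M F V p) (Q : Multisection E M F V q) :
    Multisection E M F V (p + q - 1) :=
  A.sections.schoutenTwist dualEquiv φ P Q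

/-- `φ ∈ Γ(V*)` is a `1`-cocycle of the Lie algebroid `V`. -/
def IsCocycle (A : LieAlgebroid E M F V)
    (φ : SmoothSection E M (F →L[ℝ] ℝ) (DualBundle M V)) : Prop :=
  A.sections.IsCocycle (covectorDual φ)

/-- `X ∈ Γ(V)` is a `1`-cocycle of the Lie algebroid `V*`. -/
def IsDualCocycle (A' : LieAlgebroid E M (F →L[ℝ] ℝ) (DualBundle M V))
    (X : SmoothSection E M F V) : Prop :=
  A'.sections.IsCocycle (dualEquiv X)

/-- The differential `d_*^{X₀}` on multisections of `V` defined by a Lie algebroid structure on `V*`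
and `X₀ ∈ Γ(V)`. -/
def dStarTwist (A' : LieAlgebroid E M (F →L[ℝ] ℝ) (DualBundle M V)) (X₀ : SmoothSection E M F V)
    {p : ℕ} (P : Multisection E M F V p) : Multisection E M F V (p + 1) :=
  A'.sections.dTwist (dualEquiv X₀) P

/-- The Lie derivative `L_{*α}^{X₀}` on multisections of `V` defined by a Lie algebroid structure on
`V*` and `X₀ ∈ Γ(V)`. -/
def lieStarTwist (A' : LieAlgebroid E M (F →L[ℝ] ℝ) (DualBundle M V)) (X₀ : SmoothSection E M F V)
    (α : SmoothSection E M (F →L[ℝ] ℝ) (DualBundle M V)) {p : ℕ} (P : Multisection E M F V p) :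
    Multisection E M F V p :=
  A'.sections.lieTwist (dualEquiv X₀) α P

/-- The Lie derivative `L_X^φ P = [X, P]^φ` of multisections. -/
def lieMultiTwist (A : LieAlgebroid E M F V)
    (φ : SmoothSection E M (F →L[ℝ] ℝ) (DualBundle M V)) (X : SmoothSection E M F V) {p : ℕ}
    (P : Multisection E M F V p) : Multisection E M F V p :=
  Form.castDeg (by omega) (A.schoutenTwist φ (sectionMulti X) P)

/-- The pair `((A, φ₀), (A*, X₀))` is a generalized Lie bialgebroid. -/
structure IsGeneralizedBialgebroid (A : LieAlgebroid E M F V)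
    (φ₀ : SmoothSection E M (F →L[ℝ] ℝ) (DualBundle M V))
    (A' : LieAlgebroid E M (F →L[ℝ] ℝ) (DualBundle M V))
    (X₀ : SmoothSection E M F V) : Prop where
  cocycle : A.IsCocycle φ₀
  dual_cocycle : A'.IsDualCocycle X₀
  /-- `d_*^{X₀} [X, Y] = [d_*^{X₀} X, Y]^{φ₀} + [X, d_*^{X₀} Y]^{φ₀}` -/
  d_bracket : ∀ X Y : SmoothSection E M F V,
    (A'.dStarTwist X₀ (sectionMulti (A.bracket X Y)) : Multisection E M F V 2) =
      (A.schoutenTwist φ₀ (A'.dStarTwist X₀ (sectionMulti X)) (sectionMulti Y) :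
        Multisection E M F V 2) +
      (A.schoutenTwist φ₀ (sectionMulti X) (A'.dStarTwist X₀ (sectionMulti Y)) :
        Multisection E M F V 2)
  /-- `L_{*φ₀}^{X₀} P + L_{X₀}^{φ₀} P = 0` -/
  lie_add_lie : ∀ (p : ℕ) (P : Multisection E M F V p),
    A'.lieStarTwist X₀ φ₀ P + A.lieMultiTwist φ₀ X₀ P = 0

/-- `A'` is the Lie algebroid structure on `V*` with bracket
`[α, β]_* = L^{φ₀}_{P^♯ α} β - L^{φ₀}_{P^♯ β} α - d^{φ₀}(P(α, β))` and anchor `ρ ∘ P^♯`. -/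
structure IsTriangularDual (A : LieAlgebroid E M F V)
    (φ₀ : SmoothSection E M (F →L[ℝ] ℝ) (DualBundle M V)) (P : Multisection E M F V 2)
    (A' : LieAlgebroid E M (F →L[ℝ] ℝ) (DualBundle M V)) : Prop where
  bracket_eq : ∀ α β : SmoothSection E M (F →L[ℝ] ℝ) (DualBundle M V),
    Form.ofDual (covectorDual (A'.bracket α β)) =
      A.sections.lieTwist (covectorDual φ₀) (sharp P α) (Form.ofDual (covectorDual β))
      - A.sections.lieTwist (covectorDual φ₀) (sharp P β) (Form.ofDual (covectorDual α))
      - A.sections.dTwist (covectorDual φ₀) (Form.ofFun (P ![α, β]))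
  anchor_eq : ∀ (α : SmoothSection E M (F →L[ℝ] ℝ) (DualBundle M V)) (x : M),
    A'.anchor x (α x) = A.anchor x (sharp P α x)

end LieAlgebroid

end Algebroids

end

end GLB

/-! Put ∇_X f = ρ(X)f + φ₀(X)f. Since φ₀ is a cocycle, ∇ is a representation of Γ(A) on functions
(`nabla_bracket`). Paired with a section Y, the bracket [α,β]_* is the usual bracket defined by a
bivector, with ∇ in place of ρ wherever a function is differentiated (`triangularValue`).

Evaluated on three covectors, [P,P]^{φ₀} is 2⟨γ, [P♯α, P♯β] − P♯[α,β]_*⟩, so its vanishing says that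
P♯ preserves brackets (`sharp_bracket`). The Lie algebroid axioms then pull back from A: the Jacobi
identity (`triangular_jacobi`) reduces to the one of A, the representation property of ∇, and the
scalar identity [P,P]^{φ₀} = 0 differentiated by ∇_Y; the anchor ρ ∘ P♯ is a composite of
homomorphisms. As a functional X₀ is γ ↦ φ₀(P♯γ), the pullback of a cocycle along a homomorphism,
hence a cocycle.

The two remaining identities do not use [P,P]^{φ₀} = 0 directly. On bivectors let D_X = [X,·]^{φ₀} =
L_X − φ₀(X). The cocycle condition gives D_{[X,Y]} = D_X D_Y − D_Y D_X. Since d_*^{X₀}X = −D_X P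
(`dTwist_dual_ofDual`) and [Q,Y]^{φ₀} = −D_Y Q (`schoutenTwist_two_ofDual_lie`), compatibility is
this commutator relation applied to P (`dTwist_dual_bracket`). For the last identity, [φ₀,α]_* =
−L_{X₀}α, ρ_*(φ₀) = −ρ(X₀) and P(φ₀,φ₀) = 0, so the two Lie derivatives are opposite in every degree
(`lieTwist_dual_add`).

All this is algebra over R = C^∞(M). Geometry enters only through tensoriality: functionals on Γ(A)
are sections of A* (`exists_covector`), and R-linear maps into vector fields are bundle maps
(`exists_bundleMap`). -/

namespace GLB

set_option linter.unusedSectionVars false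
set_option linter.unusedSimpArgs false

noncomputable section

/-! ### Cartan calculus for the twisted differential and Lie derivative. -/

section Cartan
variable {R Γ : Type*} [CommRing R] [Algebra ℝ R] [AddCommGroup Γ] [Module ℝ Γ] [Module R Γ]

theorem removeNth_zero_vecCons {k : ℕ} (y : Γ) (v : Fin k → Γ) :
    (0 : Fin (k + 1)).removeNth (Matrix.vecCons y v) = v := by
  funext j; simp [Fin.removeNth]

theorem removeNth_succ_vecCons {k : ℕ} (y : Γ) (v : Fin (k + 1) → Γ) (i : Fin (k + 1)) :
    i.succ.removeNth (Matrix.vecCons y v) = Matrix.vecCons y (i.removeNth v) := by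
  funext j
  refine Fin.cases ?_ (fun j => ?_) j <;> simp [Fin.removeNth, Matrix.vecCons]

theorem Form.map_update_eq_vecCons {k : ℕ} (α : Form R Γ (k + 1)) (v : Fin (k + 1) → Γ)
    (i : Fin (k + 1)) (y : Γ) :
    α (Function.update v i y) = (-1) ^ (i : ℕ) * α (Matrix.vecCons y (i.removeNth v)) := by
  have h : α (Function.update v i y) = (-1) ^ (i : ℕ) • α (Matrix.vecCons y (i.removeNth v)) := by
    rw [← AlternatingMap.map_insertNth, Fin.insertNth_removeNth]
  rw [h]
  simp

theorem Form.map_vecCons_swap {k : ℕ} (α : Form R Γ (k + 2)) (b y : Γ) (w : Fin k → Γ) :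
    α (Matrix.vecCons b (Matrix.vecCons y w)) = -α (Matrix.vecCons y (Matrix.vecCons b w)) := by
  rw [← α.map_swap (Matrix.vecCons y (Matrix.vecCons b w)) (show (0 : Fin (k + 2)) ≠ 1 by simp)]
  congr 1
  funext l
  refine Fin.cases (by simp) (fun l => ?_) l
  refine Fin.cases (by simp) (fun l => ?_) l
  have e : Equiv.swap (0 : Fin (k + 2)) 1 l.succ.succ = l.succ.succ :=
    Equiv.swap_apply_of_ne_of_ne (Fin.succ_ne_zero _) fun h =>
      Fin.succ_ne_zero l (Fin.succ_injective _ h)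
  simp [e]

namespace AnchoredBracket
variable [IsScalarTower ℝ R Γ] (A : AnchoredBracket R Γ)

theorem dAnchor_vecCons {k : ℕ} (α : Form R Γ (k + 1)) (X : Γ) (v : Fin (k + 1) → Γ) :
    A.dAnchor α (Matrix.vecCons X v) = A.anchor X (α v) - A.dAnchor (α.curryLeft X) v := by
  rw [dAnchor_apply, dAnchor_apply, Fin.sum_univ_succ, sub_eq_add_neg, ← Finset.sum_neg_distrib]
  congr 1
  · simp [removeNth_zero_vecCons]
  · refine Finset.sum_congr rfl fun i _ => ?_
    rw [removeNth_succ_vecCons]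
    simp only [Matrix.cons_val_succ, Fin.val_succ, pow_succ, AlternatingMap.curryLeft_apply_apply]
    ring

/-- Pairs of arguments that include X give the sum over [X, vᵢ]; the other pairs give the bracket
part of the differential of ι_X α, up to sign. -/
theorem dBracket_vecCons {k : ℕ} (α : Form R Γ (k + 1)) (X : Γ) (v : Fin (k + 1) → Γ) :
    A.dBracket α (Matrix.vecCons X v) = -A.dBracket (α.curryLeft X) v
      - ∑ i, α (Function.update v i (A.bracket X (v i))) := by
  -- Moving [X, vⱼ] from the front back to slot j costs (-1)^j, so only the sign -1 survives.
  have h0 : ∑ j : Fin (k + 1), (-1 : R) ^ ((j : ℕ) + 1) *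
        α (Matrix.vecCons (A.bracket X (v j)) (j.removeNth v))
      = -∑ i, α (Function.update v i (A.bracket X (v i))) := by
    rw [← Finset.sum_neg_distrib]
    refine Finset.sum_congr rfl fun i _ => ?_
    rw [Form.map_update_eq_vecCons]
    ring
  rw [dBracket_apply, Fin.sum_univ_succ]
  have e2 : Finset.Ici (0 : Fin (k + 1)) = Finset.univ := by ext; simp
  rw [e2, add_comm, sub_eq_add_neg, ← h0]
  congr 1
  · obtain _ | k := k
    · simp [dBracket]
    rw [dBracket_apply, ← Finset.sum_neg_distrib]
    refine Finset.sum_congr rfl fun i _ => ?_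
    rw [← Finset.sum_neg_distrib]
    have e3 : Finset.Ici i.succ = (Finset.Ici i).map (Fin.succEmb (k + 1)) :=
      (Fin.map_succEmb_Ici i).symm
    rw [e3, Finset.sum_map]
    refine Finset.sum_congr rfl fun j _ => ?_
    have hk : (j.succ.removeNth <| i.succ.castSucc.removeNth (Matrix.vecCons X v))
        = Matrix.vecCons X (j.removeNth (i.castSucc.removeNth v)) := by
      rw [← Fin.succ_castSucc, removeNth_succ_vecCons]
      exact removeNth_succ_vecCons _ _ _
    have c1 : (Matrix.vecCons X v : Fin (k + 1 + 2) → Γ) i.succ.castSucc = v i.castSucc := by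
      rw [← Fin.succ_castSucc]; simp
    have c2 : (Matrix.vecCons X v : Fin (k + 1 + 2) → Γ) j.succ.succ = v j.succ := by simp
    simp only [Fin.coe_succEmb]
    -- Both indices are shifted by one, so (-1)^{i+j} is unchanged; the minus sign comes from
    -- exchanging the bracket with X.
    rw [hk, c1, c2, Form.map_vecCons_swap, AlternatingMap.curryLeft_apply_apply]
    simp only [Fin.val_succ]
    ring
  · refine Finset.sum_congr rfl fun j _ => ?_
    simp [removeNth_zero_vecCons]

/-- Cartan's magic formula: splitting X off as first argument makes the terms of d(ι_X α) cancel. -/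
theorem d_contract_add_contract_d {k : ℕ} (α : Form R Γ (k + 1)) (X : Γ) (v : Fin (k + 1) → Γ) :
    A.d (α.curryLeft X) v + A.d α (Matrix.vecCons X v) =
      A.anchor X (α v) - ∑ i, α (Function.update v i (A.bracket X (v i))) := by
  change (A.dAnchor (α.curryLeft X) v + A.dBracket (α.curryLeft X) v)
    + (A.dAnchor α (Matrix.vecCons X v) + A.dBracket α (Matrix.vecCons X v)) = _
  rw [dAnchor_vecCons, dBracket_vecCons]
  ring

/-- Contraction is an antiderivation, so its anticommutator with φ ∧ · is multiplication by φ(X). -/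
theorem wedgeOne_contract_add_contract_wedgeOne (φ : Γ →ₗ[R] R) {k : ℕ} (α : Form R Γ (k + 1))
    (X : Γ) (v : Fin (k + 1) → Γ) :
    Form.wedgeOne φ (α.curryLeft X) v + Form.wedgeOne φ α (Matrix.vecCons X v) = φ X * α v := by
  rw [Form.wedgeOne_apply, Form.wedgeOne_apply, Fin.sum_univ_succ (n := k + 1), add_left_comm,
    ← Finset.sum_add_distrib, Finset.sum_eq_zero]
  · simp [removeNth_zero_vecCons]
  · intro i _
    rw [removeNth_succ_vecCons]
    simp only [Matrix.cons_val_succ, Fin.val_succ, pow_succ, AlternatingMap.curryLeft_apply_apply]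
    ring

theorem dTwist_zero_apply (φ : Γ →ₗ[R] R) (α : Form R Γ 0) (X : Fin 1 → Γ) :
    A.dTwist φ α X = A.anchor (X 0) (α Fin.elim0) + φ (X 0) * α Fin.elim0 := by
  rw [dTwist, AlternatingMap.add_apply, d_apply_zero, Form.wedgeOne_apply]
  rw [Fin.sum_univ_succ, Subsingleton.elim (Fin.removeNth 0 X) Fin.elim0]
  simp

/-- The Cartan formula
`(L^φ_X α)(v) = ρ(X) α(v) + φ(X) α(v) - ∑ᵢ α(v₁, …, [X, vᵢ], …, v_k)`. -/
theorem lieTwist_apply (φ : Γ →ₗ[R] R) (X : Γ) {k : ℕ} (α : Form R Γ k) (v : Fin k → Γ) :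
    A.lieTwist φ X α v = A.anchor X (α v) + φ X * α v
      - ∑ i, α (Function.update v i (A.bracket X (v i))) := by
  cases k with
  | zero =>
    have h : A.lieTwist φ X α v = A.dTwist φ α (Matrix.vecCons X v) := rfl
    rw [h, dTwist_zero_apply, Subsingleton.elim v Fin.elim0]
    simp
  | succ k =>
    have h : A.lieTwist φ X α v = (A.d (α.curryLeft X) v + Form.wedgeOne φ (α.curryLeft X) v)
        + (A.d α (Matrix.vecCons X v) + Form.wedgeOne φ α (Matrix.vecCons X v)) := rfl
    rw [h]
    linear_combination A.d_contract_add_contract_d α X v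
      + wedgeOne_contract_add_contract_wedgeOne φ α X v

theorem lieTwist_ofDual (φ β : Γ →ₗ[R] R) (X : Γ) (v : Fin 1 → Γ) :
    A.lieTwist φ X (Form.ofDual β) v =
      A.anchor X (β (v 0)) + φ X * β (v 0) - β (A.bracket X (v 0)) := by
  simp [lieTwist_apply, Form.ofDual]

theorem dTwist_ofDual (φ β : Γ →ₗ[R] R) (X Y : Γ) :
    A.dTwist φ (Form.ofDual β) ![X, Y] = A.anchor X (β Y) - A.anchor Y (β X) - β (A.bracket X Y)
      + φ X * β Y - φ Y * β X := by
  -- The degree-one case is read off from the magic formula: dβ(X, Y) is (L_X β)(Y) minus the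
  -- derivative of β(X) along Y.
  have h := A.d_contract_add_contract_d (Form.ofDual β) X ![Y]
  have h' := wedgeOne_contract_add_contract_wedgeOne φ (Form.ofDual β) X ![Y]
  rw [d_apply_zero] at h
  rw [Form.wedgeOne_apply] at h'
  simp [Form.ofDual] at h h'
  rw [dTwist, AlternatingMap.add_apply]
  simp only [Form.ofDual]
  linear_combination h + h'

end AnchoredBracket
end Cartan

/-! ### Explicit formulas for wedge products and Schouten brackets in low degree. -/

section Schouten

theorem sum_perm_fin_two {N : Type*} [AddCommMonoid N] (g : Equiv.Perm (Fin 2) → N) :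
    ∑ σ, g σ = g 1 + g (Equiv.swap 0 1) := by
  have h : (Finset.univ : Finset (Equiv.Perm (Fin 2))) = {1, Equiv.swap 0 1} := by decide
  rw [h, Finset.sum_pair (by decide)]

theorem sum_perm_fin_three {N : Type*} [AddCommMonoid N] (g : Equiv.Perm (Fin 3) → N) :
    ∑ σ, g σ = g 1 + (g (Equiv.swap 0 1) + (g (Equiv.swap 0 2) + (g (Equiv.swap 1 2)
      + (g (finRotate 3) + g (finRotate 3).symm)))) := by
  have h : (Finset.univ : Finset (Equiv.Perm (Fin 3))) = {1, Equiv.swap 0 1, Equiv.swap 0 2,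
    Equiv.swap 1 2, finRotate 3, (finRotate 3).symm} := by decide
  rw [h, Finset.sum_insert (by decide), Finset.sum_insert (by decide),
    Finset.sum_insert (by decide), Finset.sum_insert (by decide), Finset.sum_pair (by decide)]

theorem sum_sign_perm_fin_two {N D : Type*} [AddCommGroup N] (g : D → D → N) (x y : D) :
    ∑ σ : Equiv.Perm (Fin 2), Equiv.Perm.sign σ • g (![x, y] (σ 0)) (![x, y] (σ 1))
      = g x y - g y x := by
  rw [sum_perm_fin_two]
  simp [sub_eq_add_neg]

theorem sum_sign_perm_fin_three {N D : Type*} [AddCommGroup N] (g : D → D → D → N) (x y z : D) :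
    ∑ σ : Equiv.Perm (Fin 3), Equiv.Perm.sign σ •
        g (![x, y, z] (σ 0)) (![x, y, z] (σ 1)) (![x, y, z] (σ 2))
      = g x y z - g y x z - g z y x - g x z y + g y z x + g z x y := by
  have s1 : Equiv.Perm.sign (finRotate 3) = 1 := by decide
  have s2 : Equiv.Perm.sign (finRotate 3).symm = 1 := by decide
  have h01 : Equiv.swap (0 : Fin 3) 1 2 = 2 := by decide
  have h02 : Equiv.swap (0 : Fin 3) 2 1 = 1 := by decide
  have h12 : Equiv.swap (1 : Fin 3) 2 0 = 0 := by decide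
  have r0 : finRotate 3 0 = 1 := by decide
  have r1 : finRotate 3 1 = 2 := by decide
  have r2 : finRotate 3 2 = 0 := by decide
  have t0 : (finRotate 3).symm 0 = 2 := by decide
  have t1 : (finRotate 3).symm 1 = 0 := by decide
  have t2 : (finRotate 3).symm 2 = 1 := by decide
  have d02 : (0 : Fin 3) ≠ 2 := by decide
  have d12 : (1 : Fin 3) ≠ 2 := by decide
  have d01 : (0 : Fin 3) ≠ 1 := by decide
  rw [sum_perm_fin_three, s1, s2, h01, h02, h12, r0, r1, r2, t0, t1, t2,
    Equiv.Perm.sign_swap d01, Equiv.Perm.sign_swap d02, Equiv.Perm.sign_swap d12]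
  simp only [Equiv.swap_apply_left, Equiv.swap_apply_right, Equiv.Perm.sign_one,
    Equiv.Perm.one_apply, one_smul, Units.neg_smul]
  change g x y z + (-g y x z + (-g z y x + (-g x z y + (g y z x + g z x y)))) = _
  abel

/-- Each index is the image of 0 under exactly n! permutations. -/
theorem sum_perm_apply_zero {N : Type*} [AddCommMonoid N] {n : ℕ} (g : Fin (n + 1) → N) :
    ∑ σ : Equiv.Perm (Fin (n + 1)), g (σ 0) = n.factorial • ∑ i, g i := by
  rw [← Equiv.sum_comp Equiv.Perm.decomposeFin.symm, Fintype.sum_prod_type, Finset.smul_sum]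
  refine Finset.sum_congr rfl fun i _ => ?_
  simp [Fintype.card_perm]

variable {R Γ D : Type*} [CommRing R] [Algebra ℝ R] [AddCommGroup Γ] [Module ℝ Γ] [Module R Γ]
  [IsScalarTower ℝ R Γ] [AddCommGroup D] [Module ℝ D] [Module R D] [IsScalarTower ℝ R D]
  (e : Γ ≃ₗ[R] Module.Dual R D)

/-- Replaces the sum over shuffles by one over all permutations: every shuffle is counted k! l!
times. The factor stays on the left and is cancelled later, R being a real algebra. -/
theorem Form.factorial_smul_wedge_apply {k l : ℕ} (α : Form R D k) (β : Form R D l)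
    (v : Fin (k + l) → D) :
    (k.factorial * l.factorial) • Form.wedge α β v =
      ∑ σ : Equiv.Perm (Fin (k + l)), Equiv.Perm.sign σ •
        (α (fun i => v (σ (Fin.castAdd l i))) * β (fun i => v (σ (Fin.natAdd k i)))) := by
  have h := congrArg (fun m => (LinearMap.mul' R R) (m (v ∘ finSumFinEquiv)))
    (MultilinearMap.domCoprod_alternization_eq α β)
  simp only [AlternatingMap.smul_apply, Fintype.card_fin, map_nsmul] at h
  rw [Form.wedge, AlternatingMap.domDomCongr_apply]
  refine h.symm.trans ?_
  rw [MultilinearMap.alternatization_apply, map_sum,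
    ← Equiv.sum_comp (Equiv.permCongr finSumFinEquiv)]
  refine Finset.sum_congr rfl fun σ _ => ?_
  rw [Equiv.Perm.sign_permCongr]
  simp [MultilinearMap.domDomCongr_apply, MultilinearMap.domCoprod_apply]

theorem nsmul_right_cancel {n : ℕ} (hn : n ≠ 0) {x y : R} (h : n • x = n • y) : x = y := by
  have h1 : (n : ℝ) • x = (n : ℝ) • y := by simpa [Nat.cast_smul_eq_nsmul] using h
  have hn' : (n : ℝ) ≠ 0 := Nat.cast_ne_zero.2 hn
  rw [← inv_smul_smul₀ hn' x, h1, inv_smul_smul₀ hn']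

theorem Form.castDeg_apply {k l : ℕ} (h : k = l) (α : Form R D k) (v : Fin l → D) :
    Form.castDeg h α v = α fun i => v (Fin.cast h i) := rfl

theorem Form.map_perm' {k : ℕ} (α : Form R D k) (v : Fin k → D) (σ : Equiv.Perm (Fin k)) :
    Equiv.Perm.sign σ • α (fun i => v (σ i)) = α v := by
  have h := α.map_perm v σ
  change α (fun i => v (σ i)) = _ at h
  rw [h, smul_smul]
  simp

theorem Form.castDeg_wedge_zero {l : ℕ} (f : Form R D 0) (β : Form R D l) :
    Form.castDeg (Nat.zero_add l) (Form.wedge f β) = f Fin.elim0 • β := by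
  ext v
  refine nsmul_right_cancel (Nat.factorial_ne_zero l) ?_
  have h := Form.factorial_smul_wedge_apply f β fun i => v (Fin.cast (Nat.zero_add l) i)
  rw [Nat.factorial_zero, one_mul] at h
  rw [Form.castDeg_apply, h]
  -- A function has no slots to permute, so by antisymmetry of β all l! summands coincide.
  have hσ : ∀ σ : Equiv.Perm (Fin (0 + l)), Equiv.Perm.sign σ •
      (f (fun i => v (Fin.cast (Nat.zero_add l) (σ (Fin.castAdd l i)))) *
        β (fun i => v (Fin.cast (Nat.zero_add l) (σ (Fin.natAdd 0 i)))))
      = f Fin.elim0 * β v := by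
    intro σ
    have h2 := Form.map_perm' (Form.castDeg (Nat.zero_add l).symm β)
      (fun i => v (Fin.cast (Nat.zero_add l) i)) σ
    simp only [Form.castDeg_apply] at h2
    rw [← mul_smul_comm, Subsingleton.elim (fun i => v _) (Fin.elim0 : Fin 0 → D)]
    congr 1
    refine Eq.trans ?_ h2
    simp only [Fin.natAdd_zero]
  rw [Finset.sum_congr rfl fun σ _ => hσ σ]
  simp [Fintype.card_perm]

theorem Form.wedge_zero {k : ℕ} (α : Form R D k) (f : Form R D 0) :
    Form.wedge α f = f Fin.elim0 • α := by
  ext v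
  refine nsmul_right_cancel (Nat.factorial_ne_zero k) ?_
  have h := Form.factorial_smul_wedge_apply α f v
  rw [Nat.factorial_zero, mul_one] at h
  rw [h]
  have hσ : ∀ σ : Equiv.Perm (Fin (k + 0)), Equiv.Perm.sign σ •
      (α (fun i => v (σ (Fin.castAdd 0 i))) * f (fun i => v (σ (Fin.natAdd k i))))
      = f Fin.elim0 * α v := by
    intro σ
    rw [← smul_mul_assoc, Subsingleton.elim (fun i => v _) (Fin.elim0 : Fin 0 → D), mul_comm]
    congr 1
    exact Form.map_perm' α v σ
  rw [Finset.sum_congr rfl fun σ _ => hσ σ]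
  simp [Fintype.card_perm]

theorem Form.map_pair_swap (Q : Form R D 2) (x y : D) : Q ![y, x] = -Q ![x, y] :=
  Form.map_vecCons_swap Q y x ![]

theorem Form.apply_two (Q : Form R D 2) (v : Fin 2 → D) : Q v = Q ![v 0, v 1] := by
  congr 1
  funext i
  fin_cases i <;> rfl

theorem Form.apply_one (θ : Form R D 1) (v : Fin 1 → D) : θ v = θ ![v 0] := by
  congr 1
  funext i
  fin_cases i; rfl

theorem Form.wedge_two_one (Q : Form R D 2) (θ : Form R D 1) (x y z : D) :
    Form.wedge Q θ ![x, y, z] =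
      Q ![x, y] * θ ![z] + Q ![y, z] * θ ![x] + Q ![z, x] * θ ![y] := by
  refine nsmul_right_cancel two_ne_zero ?_
  have h := (Form.factorial_smul_wedge_apply Q θ ![x, y, z]).trans
    ((Finset.sum_congr rfl fun σ _ => by rw [Form.apply_two Q, Form.apply_one θ]; rfl).trans
    (sum_sign_perm_fin_three (fun a b c => Q ![a, b] * θ ![c]) x y z))
  refine Eq.trans ?_ (h.trans ?_)
  · simp
  · rw [Q.map_pair_swap x y, Q.map_pair_swap y z, Q.map_pair_swap z x, two_nsmul]
    ring

theorem Form.wedge_one_two (θ : Form R D 1) (Q : Form R D 2) (x y z : D) :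
    Form.wedge θ Q ![x, y, z] =
      Q ![x, y] * θ ![z] + Q ![y, z] * θ ![x] + Q ![z, x] * θ ![y] := by
  refine nsmul_right_cancel two_ne_zero ?_
  have h := (Form.factorial_smul_wedge_apply θ Q ![x, y, z]).trans
    ((Finset.sum_congr rfl fun σ _ => by rw [Form.apply_two Q, Form.apply_one θ]; rfl).trans
    (sum_sign_perm_fin_three (fun a b c => θ ![a] * Q ![b, c]) x y z))
  refine Eq.trans ?_ (h.trans ?_)
  · simp
  · rw [Q.map_pair_swap x y, Q.map_pair_swap y z, Q.map_pair_swap z x, two_nsmul]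
    ring

/-- `insertRest` leaves the first slot free while ♯ leaves the second one free; hence the sign. -/
theorem insertRest_one (P : Form R D 2) (s : D → Γ) (hs : ∀ α β, e (s α) β = P ![α, β])
    (J : Fin 1 → D) : insertRest e P J = -s (J 0) := by
  apply e.injective
  ext β
  rw [pair_insertRest, map_neg, LinearMap.neg_apply, hs, ← Form.map_pair_swap]
  congr 1
  funext i
  fin_cases i <;> rfl

theorem insertRest_ofDual (X : Γ) (J : Fin 0 → D) : insertRest e (Form.ofDual (e X)) J = X := by
  apply e.injective
  ext β
  rw [pair_insertRest]
  rfl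

namespace AnchoredBracket
variable (A : AnchoredBracket R Γ)

/-- The signs of the two `insertRest` cancel in the bracket. Among the six permutations each cyclic
bracket term occurs twice with weight 1 and each anchor term four times with weight 1/2, which gives
the overall factor 2. -/
theorem schoutenPos_two_two (P : Form R D 2) (s : D → Γ) (hs : ∀ α β, e (s α) β = P ![α, β])
    (x y z : D) : A.schoutenPos e P P ![x, y, z] =
      2 * (e (A.bracket (s x) (s y)) z + e (A.bracket (s y) (s z)) x + e (A.bracket (s z) (s x)) y
        - A.anchor (s x) (P ![y, z]) - A.anchor (s y) (P ![z, x]) - A.anchor (s z) (P ![x, y])) := by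
  rw [schoutenPos_apply]
  have hT : ∀ v : Fin 3 → D, A.schoutenTerm e P P (p := 1) (q := 1) v =
    e (A.bracket (s (v 1)) (s (v 2))) (v 0) - (1 / 2 : ℝ) • A.anchor (s (v 1)) (P ![v 2, v 0])
      + (1 / 2 : ℝ) • A.anchor (s (v 2)) (P ![v 1, v 0]) := by
    intro v
    simp only [schoutenTerm, insertRest_one e P s hs, map_neg, LinearMap.neg_apply, neg_neg,
      Derivation.neg_apply, hs]
    norm_num [Algebra.smul_def]
    change e (A.bracket (s (v 1)) (s (v 2))) (v 0) - _ * A.anchor (s (v 1)) (P ![v 2, v 0])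
      + _ * A.anchor (s (v 2)) (P ![v 1, v 0]) = _
    rfl
  simp only [hT]
  have h := (sum_sign_perm_fin_three
    (fun a b c => e (A.bracket (s b) (s c)) a - (1 / 2 : ℝ) • A.anchor (s b) (P ![c, a])
      + (1 / 2 : ℝ) • A.anchor (s c) (P ![b, a])) x y z)
  refine (congrArg _ h).trans ?_
  rw [P.map_pair_swap x y, P.map_pair_swap y z, P.map_pair_swap z x,
    A.bracket_swap (s y) (s x), A.bracket_swap (s z) (s y), A.bracket_swap (s x) (s z), two_mul]
  simp only [map_neg, LinearMap.neg_apply, Nat.factorial_one, Nat.cast_one, mul_one, div_one,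
    one_smul]
  module

theorem schoutenPos_two_one (Q : Form R D 2) (Y : Γ) (r : D → Γ)
    (hr : ∀ α β, e (r α) β = Q ![α, β]) (x y : D) :
    A.schoutenPos e Q (Form.ofDual (e Y)) ![x, y] =
      e (A.bracket Y (r y)) x - e (A.bracket Y (r x)) y + A.anchor Y (Q ![x, y]) := by
  rw [schoutenPos_apply]
  have hT : ∀ v : Fin 2 → D, A.schoutenTerm e Q (Form.ofDual (e Y)) (p := 1) (q := 0) v =
    e (A.bracket Y (r (v 1))) (v 0) - (1 / 2 : ℝ) • A.anchor Y (Q ![v 1, v 0]) := by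
    intro v
    simp only [schoutenTerm, insertRest_one e Q r hr, insertRest_ofDual, map_neg,
      LinearMap.neg_apply, neg_neg, Derivation.neg_apply, hr, A.bracket_swap (r _) Y]
    norm_num [Algebra.smul_def]
    change e (A.bracket Y (r (v 1))) (v 0) + - (_ * A.anchor Y (Q ![v 1, v 0])) = _
    ring
  simp only [hT]
  have h := (sum_sign_perm_fin_two
    (fun a b => e (A.bracket Y (r b)) a - (1 / 2 : ℝ) • A.anchor Y (Q ![b, a])) x y)
  refine (congrArg _ h).trans ?_
  rw [Q.map_pair_swap x y]
  simp only [map_neg, Nat.factorial_one, Nat.factorial_zero, Nat.cast_one, mul_one, div_one,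
    one_smul]
  module

/-- Bracketing with a section is the Lie derivative. The operator ℓ, dual to [X,·], is a parameter
because nothing yet ensures that it takes values in D rather than in the dual of Γ. -/
theorem schoutenPos_one (X : Γ) (ℓ : D → D)
    (hℓ : ∀ α Y, e Y (ℓ α) = A.anchor X (e Y α) - e (A.bracket X Y) α) {q : ℕ}
    (Q : Form R D (q + 1)) (v : Fin (q + 1) → D) :
    Form.castDeg (by omega) (A.schoutenPos e (Form.ofDual (e X)) Q) v =
      A.anchor X (Q v) - ∑ i, Q (Function.update v i (ℓ (v i))) := by
  rw [Form.castDeg_apply, schoutenPos_apply]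
  have h0 : 0 + q + 1 = q + 1 := by omega
  set Q' : Form R D (0 + q + 1) := Form.castDeg h0.symm Q with hQ'
  -- By duality ⟨w₀, [X, Y]⟩ = ρ(X)⟨w₀, Y⟩ − ⟨ℓ w₀, Y⟩, and the correction −q/(q+1) leaves the
  -- weight 1/(q+1) on the first term.
  have hT : ∀ w : Fin (0 + q + 1) → D, A.schoutenTerm e (Form.ofDual (e X)) Q w =
      (1 / ((q : ℝ) + 1)) • A.anchor X (Q' w) - Q' (Function.update w 0 (ℓ (w 0))) := by
    intro w
    have hq : (q : ℝ) / (q + 1) = 1 - 1 / (q + 1) := by field_simp; ring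
    have h1 : ∀ β, e (insertRest e Q fun i => w (Fin.natAdd 0 i).succ) β
        = Q' (Function.update w 0 β) := by
      intro β
      rw [pair_insertRest, hQ', Form.castDeg_apply]
      congr 1
      funext i
      refine Fin.cases ?_ (fun i => ?_) i
      · simp
      · have : Fin.cast h0.symm i.succ = (Fin.natAdd 0 i).succ := by ext; simp
        rw [this]
        simp
    have h2 := hℓ (w 0) (insertRest e Q fun i => w (Fin.natAdd 0 i).succ)
    rw [h1, h1, Function.update_eq_self] at h2
    simp only [schoutenTerm, insertRest_ofDual]
    rw [h1, Function.update_eq_self, hq, sub_smul, h2]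
    simp
    abel
  set w : Fin (0 + q + 1) → D := fun l => v (Fin.cast h0 l) with hw
  have hQw : Q' w = Q v := rfl
  have hσ : ∀ σ : Equiv.Perm (Fin (0 + q + 1)), Equiv.Perm.sign σ •
      A.schoutenTerm e (Form.ofDual (e X)) Q (fun l => w (σ l)) =
      (1 / ((q : ℝ) + 1)) • A.anchor X (Q v) - Q' (Function.update w (σ 0) (ℓ (w (σ 0)))) := by
    intro σ
    have hu : Function.update (fun l => w (σ l)) 0 (ℓ (w (σ 0)))
        = fun l => Function.update w (σ 0) (ℓ (w (σ 0))) (σ l) := by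
      funext l
      simp [Function.update_apply]
    have hc : ∀ y : R, Equiv.Perm.sign σ • A.anchor X y = A.anchor X (Equiv.Perm.sign σ • y) := by
      intro y
      rcases Int.units_eq_one_or (Equiv.Perm.sign σ) with h | h <;> rw [h] <;> simp
    rw [hT, smul_sub, hu, Form.map_perm' Q', smul_comm, hc, Form.map_perm' Q', hQw]
  have hsum : ∑ i, Q' (Function.update w i (ℓ (w i)))
      = ∑ i, Q (Function.update v i (ℓ (v i))) := by
    rw [← Equiv.sum_comp (finCongr h0.symm)]
    refine Finset.sum_congr rfl fun i _ => ?_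
    rw [hQ', Form.castDeg_apply]
    congr 1
    funext l
    simp [Function.update_apply, hw, Fin.ext_iff]
  change (1 / (((0).factorial : ℝ) * q.factorial)) • ∑ σ : Equiv.Perm (Fin (0 + q + 1)),
    Equiv.Perm.sign σ • A.schoutenTerm e (Form.ofDual (e X)) Q (fun l => w (σ l)) = _
  rw [Finset.sum_congr rfl fun σ _ => hσ σ, Finset.sum_sub_distrib, Finset.sum_const,
    sum_perm_apply_zero fun i => Q' (Function.update w i (ℓ (w i))), hsum, Finset.card_univ,
    Fintype.card_perm, Fintype.card_fin, ← Nat.cast_smul_eq_nsmul ℝ, ← Nat.cast_smul_eq_nsmul ℝ,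
    zero_add, smul_sub, smul_smul, smul_smul, smul_smul, Nat.factorial_succ]
  have hq : (q.factorial : ℝ) ≠ 0 := Nat.cast_ne_zero.2 (Nat.factorial_ne_zero q)
  have hq' : (q : ℝ) + 1 ≠ 0 := by positivity
  -- The anchor term occurs (q+1)! times with weight 1/(q+1), each ℓ-term q! times; after division
  -- by q! both have coefficient 1.
  have c1 : 1 / (((0).factorial : ℝ) * q.factorial) * (((q + 1) * q.factorial : ℕ) : ℝ)
      * (1 / ((q : ℝ) + 1)) = 1 := by
    rw [Nat.factorial_zero]; push_cast; field_simp
  have c2 : 1 / (((0).factorial : ℝ) * q.factorial) * (q.factorial : ℝ) = 1 := by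
    rw [Nat.factorial_zero]; push_cast; field_simp
  rw [c1, c2, one_smul, one_smul]

/-- The Lie derivative `[X, Q]^φ` of multisections, with `ℓ` the Lie derivative on `D`. -/
theorem schoutenTwist_ofDual_left (φ : D) (X : Γ) (ℓ : D → D)
    (hℓ : ∀ α Y, e Y (ℓ α) = A.anchor X (e Y α) - e (A.bracket X Y) α) {q : ℕ} (h : 1 + q - 1 = q)
    (Q : Form R D q) (v : Fin q → D) :
    Form.castDeg h (A.schoutenTwist e φ (Form.ofDual (e X)) Q) v =
      A.anchor X (Q v) - ((q : R) - 1) * (e X φ * Q v)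
        - ∑ i, Q (Function.update v i (ℓ (v i))) := by
  have hc : Form.castDeg h (contractWedge φ (Form.ofDual (e X)) Q) = e X φ • Q :=
    Form.castDeg_wedge_zero ((Form.ofDual (e X)).curryLeft φ) Q
  have hs : Form.castDeg h (A.schouten e (Form.ofDual (e X)) Q) v =
      A.anchor X (Q v) - ∑ i, Q (Function.update v i (ℓ (v i))) := by
    -- Degree zero is separate: there the bracket is a contraction with the differential of the
    -- function, not `schoutenPos`.
    cases q with
    | zero =>
      have h1 : A.schouten e (Form.ofDual (e X)) Q
        = (-1 : ℤ) ^ 0 • A.contractDiff e (Q Fin.elim0) (Form.ofDual (e X)) := rfl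
      rw [h1, pow_zero, one_smul, Finset.univ_eq_empty, Finset.sum_empty, sub_zero,
        Subsingleton.elim v Fin.elim0]
      change A.anchor (insertRest e (Form.ofDual (e X)) _) (Q Fin.elim0) = _
      rw [insertRest_ofDual]
    | succ q => exact A.schoutenPos_one e X ℓ hℓ Q v
  have hd : Form.castDeg h (A.schoutenTwist e φ (Form.ofDual (e X)) Q) v =
      Form.castDeg h (A.schouten e (Form.ofDual (e X)) Q) v
        + (((1 : ℕ) : ℤ) - 1) • Form.castDeg h (wedgeContract φ (Form.ofDual (e X)) Q) v
        - ((-1) ^ (1 + 1) * ((q : ℤ) - 1)) • Form.castDeg h (contractWedge φ (Form.ofDual (e X)) Q) v :=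
    rfl
  -- The coefficient r − 1 of the other correction vanishes, since X has degree 1.
  rw [hd, hs, hc, AlternatingMap.smul_apply]
  simp
  ring

theorem schoutenTwist_two_ofDual (φ : D) (Q : Form R D 2) (Y : Γ) (r : D → Γ)
    (hr : ∀ α β, e (r α) β = Q ![α, β]) (x y : D) :
    (A.schoutenTwist e φ Q (Form.ofDual (e Y)) : Form R D 2) ![x, y] =
      e (A.bracket Y (r y)) x - e (A.bracket Y (r x)) y + A.anchor Y (Q ![x, y])
        + e Y φ * Q ![x, y] := by
  have hd : (A.schoutenTwist e φ Q (Form.ofDual (e Y)) : Form R D 2) ![x, y] =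
      A.schoutenPos e Q (Form.ofDual (e Y)) ![x, y]
      + (((2 : ℕ) : ℤ) - 1) • Form.wedge Q ((Form.ofDual (e Y)).curryLeft φ) ![x, y]
      - ((-1) ^ (2 + 1) * (((1 : ℕ) : ℤ) - 1)) •
        (contractWedge φ Q (Form.ofDual (e Y)) : Form R D 2) ![x, y] := rfl
  rw [hd, A.schoutenPos_two_one e Q Y r hr, Form.wedge_zero]
  simp [Form.ofDual]

theorem schoutenTwist_two_two (φ : D) (P : Form R D 2) (s : D → Γ)
    (hs : ∀ α β, e (s α) β = P ![α, β]) (x y z : D) :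
    (A.schoutenTwist e φ P P : Form R D 3) ![x, y, z] =
      2 * (e (A.bracket (s x) (s y)) z + e (A.bracket (s y) (s z)) x + e (A.bracket (s z) (s x)) y
        - A.anchor (s x) (P ![y, z]) - A.anchor (s y) (P ![z, x]) - A.anchor (s z) (P ![x, y])
        + P ![φ, x] * P ![y, z] + P ![φ, y] * P ![z, x] + P ![φ, z] * P ![x, y]) := by
  have hd : (A.schoutenTwist e φ P P : Form R D 3) ![x, y, z] =
      A.schoutenPos e P P ![x, y, z]
      + (((2 : ℕ) : ℤ) - 1) • Form.wedge P (P.curryLeft φ) ![x, y, z]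
      - ((-1) ^ (2 + 1) * (((2 : ℕ) : ℤ) - 1)) • Form.wedge (P.curryLeft φ) P ![x, y, z] := rfl
  rw [hd, A.schoutenPos_two_two e P s hs, Form.wedge_two_one, Form.wedge_one_two]
  simp only [AlternatingMap.curryLeft_apply_apply]
  norm_num
  ring

end AnchoredBracket
end Schouten

/-! ### The triangular structure, as algebra over a pair of modules in duality. -/

section Triangular
variable {R Γ D : Type*} [CommRing R] [Algebra ℝ R] [AddCommGroup Γ] [Module ℝ Γ] [Module R Γ]
  [IsScalarTower ℝ R Γ] [AddCommGroup D] [Module ℝ D] [Module R D] [IsScalarTower ℝ R D]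
  (e : Γ ≃ₗ[R] Module.Dual R D)

theorem Form.map_pair_sub_left (P : Form R D 2) (x y z : D) :
    P ![x - y, z] = P ![x, z] - P ![y, z] :=
  congrArg (fun m => m ![z]) (P.curryLeft.map_sub x y)

theorem Form.map_pair_sub_right (P : Form R D 2) (x y z : D) :
    P ![z, x - y] = P ![z, x] - P ![z, y] := by
  rw [P.map_pair_swap _ z, P.map_pair_sub_left, P.map_pair_swap z x, P.map_pair_swap z y]
  ring

namespace AnchoredBracket
variable (A : AnchoredBracket R Γ)

/-- The derivation-like operator `f ↦ ρ(X) f + φ(X) f`. -/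
def nabla (φ : D) (X : Γ) : R →ₗ[ℝ] R :=
  (A.anchor X : R →ₗ[ℝ] R) + LinearMap.mulLeft ℝ (e X φ)

theorem nabla_apply (φ : D) (X : Γ) (f : R) : A.nabla e φ X f = A.anchor X f + e X φ * f := rfl

/-- The zero-order part of the commutator of ∇_X and ∇_Y is ρ(X)φ(Y) − ρ(Y)φ(X), which the cocycle
condition turns into φ([X,Y]). -/
theorem nabla_bracket {φ : D}
    (hρ : ∀ X Y f, A.anchor (A.bracket X Y) f
      = A.anchor X (A.anchor Y f) - A.anchor Y (A.anchor X f))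
    (hφ : ∀ X Y, e (A.bracket X Y) φ = A.anchor X (e Y φ) - A.anchor Y (e X φ)) (X Y : Γ) (f : R) :
    A.nabla e φ (A.bracket X Y) f
      = A.nabla e φ X (A.nabla e φ Y f) - A.nabla e φ Y (A.nabla e φ X f) := by
  simp only [nabla_apply, hρ, hφ, map_add, Derivation.leibniz, smul_eq_mul]
  ring

/-- The value at `Y` of `L^φ_{s α} β - L^φ_{s β} α - d^φ ⟨β, s α⟩`. -/
def triangularValue (φ : D) (s : D → Γ) (α β : D) (Y : Γ) : R :=
  A.nabla e φ (s α) (e Y β) - e (A.bracket (s α) Y) β - (A.nabla e φ (s β) (e Y α)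
    - e (A.bracket (s β) Y) α) - A.nabla e φ Y (e (s α) β)

/-- This is −[Y, Q]^φ: the twisted bracket of a bivector with a section is skew. -/
theorem schoutenTwist_two_ofDual_lie (φ : D) (Q : Form R D 2) (Y : Γ) (ℓ : D → D)
    (hℓ : ∀ α Z, e Z (ℓ α) = A.anchor Y (e Z α) - e (A.bracket Y Z) α) (x y : D) :
    (A.schoutenTwist e φ Q (Form.ofDual (e Y)) : Form R D 2) ![x, y] =
      -(A.anchor Y (Q ![x, y]) - Q ![ℓ x, y] - Q ![x, ℓ y]) + e Y φ * Q ![x, y] := by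
  -- A ♯ map for an arbitrary bivector; −Q corrects for the free slot being the first.
  have hr : ∀ α β, e (insertRest e (-Q) ![α]) β = Q ![α, β] := fun α β => by
    rw [pair_insertRest, AlternatingMap.neg_apply]
    exact (Q.map_pair_swap β α).symm
  have h1 := hℓ x (insertRest e (-Q) ![y])
  have h2 := hℓ y (insertRest e (-Q) ![x])
  rw [hr, hr] at h1 h2
  rw [A.schoutenTwist_two_ofDual e φ Q Y (fun α => insertRest e (-Q) ![α]) hr]
  rw [Q.map_pair_swap (ℓ x) y, Q.map_pair_swap x y, map_neg] at h1
  linear_combination h1 - h2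

variable {e} in
-- The Lie derivative of α along X is R-linear in Y because the two derivatives of the coefficient
-- cancel. As e identifies only Γ with the dual of D, the hypothesis `hc'` is needed to realize the
-- functional in D.
theorem exists_lieDual (hc' : ∀ ξ : Module.Dual R Γ, ∃ α, ∀ Y, e Y α = ξ Y) (X : Γ) (α : D) :
    ∃ β, ∀ Y, e Y β = A.anchor X (e Y α) - e (A.bracket X Y) α :=
  hc'
    { toFun := fun Y => A.anchor X (e Y α) - e (A.bracket X Y) α
      map_add' := fun Y Z => by simp only [map_add, LinearMap.add_apply]; ring
      map_smul' := fun f Y => by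
        simp only [map_add, map_smul, LinearMap.add_apply, LinearMap.smul_apply, A.leibniz,
          smul_eq_mul, Derivation.leibniz, RingHom.id_apply]
        ring }

variable {e A} {φ : D} {P : Form R D 2} {s : D → Γ} (hs : ∀ α β, e (s α) β = P ![α, β])
include hs

theorem sharp_skew (α β : D) : e (s α) β = -e (s β) α := by
  rw [hs, hs, Form.map_pair_swap]

theorem sharp_add (α β : D) : s (α + β) = s α + s β := by
  apply e.injective
  ext γ
  rw [sharp_skew hs, map_add, map_add, LinearMap.add_apply, sharp_skew hs α, sharp_skew hs β]
  ring

theorem sharp_smul (f : R) (α : D) : s (f • α) = f • s α := by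
  apply e.injective
  ext γ
  rw [sharp_skew hs, map_smul, map_smul, LinearMap.smul_apply, sharp_skew hs α]
  simp

section Bracket
variable {B : D → D → D} (hB : ∀ α β Y, e Y (B α β) = A.triangularValue e φ s α β Y)
include hB

/-- If `[P, P]^φ = 0`, then `P^♯` is a homomorphism. -/
theorem sharp_bracket (hP : A.schoutenTwist e φ P P = 0) (α β : D) :
    s (B α β) = A.bracket (s α) (s β) := by
  apply e.injective
  ext γ
  have h := (A.schoutenTwist_two_two e φ P s hs α β γ).symm.trans
    (congrArg (fun m : Form R D 3 => m ![α, β, γ]) hP)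
  change 2 * _ = (0 : R) at h
  -- The identity from `hP` is twice ⟨γ, [s α, s β] − s (B α β)⟩ = 0, once all pairings are brought
  -- into one order by skewness.
  refine nsmul_right_cancel two_ne_zero ?_
  rw [nsmul_eq_mul, nsmul_eq_mul, Nat.cast_ofNat, sharp_skew hs (B α β) γ, hB, triangularValue]
  simp only [← hs, nabla_apply] at h ⊢
  rw [A.bracket_swap (s γ) (s α)] at h
  rw [sharp_skew hs φ α, sharp_skew hs φ β, sharp_skew hs φ γ, sharp_skew hs γ α] at h
  rw [sharp_skew hs γ β, sharp_skew hs γ α]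
  simp only [map_neg, LinearMap.neg_apply] at h ⊢
  linear_combination -h

variable (hc : ∀ α β : D, (∀ Y, e Y α = e Y β) → α = β)

include hc in
theorem triangular_self (α : D) : B α α = 0 := by
  refine hc _ _ fun Y => ?_
  have h0 : e (s α) α = 0 := by
    rw [hs]
    exact P.map_eq_zero_of_eq ![α, α] (i := 0) (j := 1) rfl (by simp)
  rw [hB, triangularValue, h0]
  simp

include hc in
-- Differentiating f along Y yields −(ρ(Y)f)⟨α, s β⟩ from the bracket with f • s β and −(ρ(Y)f)⟨β, s
-- α⟩ from the last term; they cancel by skewness of s, leaving only ρ(s α)f.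
theorem triangular_smul_right (f : R) (α β : D) :
    B α (f • β) = f • B α β + A.anchor (s α) f • β := by
  refine hc _ _ fun Y => ?_
  have h := sharp_skew hs β α
  simp only [hB, triangularValue, nabla_apply, sharp_smul hs, map_add, map_smul, smul_eq_mul,
    Derivation.leibniz, bracket_smul_left, map_sub, LinearMap.sub_apply, LinearMap.smul_apply,
    Derivation.smul_apply, h]
  ring

include hc in
theorem triangular_add_left (α β γ : D) : B (α + β) γ = B α γ + B β γ := by
  refine hc _ _ fun Y => ?_
  simp only [hB, triangularValue, nabla_apply, sharp_add hs, map_add, LinearMap.add_apply,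
    Derivation.add_apply]
  ring

include hc in
theorem triangular_add_right (α β γ : D) : B α (β + γ) = B α β + B α γ := by
  refine hc _ _ fun Y => ?_
  simp only [hB, triangularValue, nabla_apply, sharp_add hs, map_add, LinearMap.add_apply,
    Derivation.add_apply]
  ring

include hc in
-- A special case of the Leibniz rule, since derivations kill real constants.
theorem triangular_real_smul_right (c : ℝ) (α β : D) : B α (c • β) = c • B α β := by
  rw [real_smul_eq (R := R) c β, triangular_smul_right hs hB hc, Derivation.map_algebraMap,
    zero_smul, add_zero, ← real_smul_eq]

include hc in
theorem triangular_swap (α β : D) : B α β = -B β α := by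
  have h := triangular_self hs hB hc (α + β)
  rw [triangular_add_left hs hB hc, triangular_add_right hs hB hc, triangular_add_right hs hB hc,
    triangular_self hs hB hc, triangular_self hs hB hc, zero_add, add_zero] at h
  exact eq_neg_of_add_eq_zero_left h

include hc in
theorem triangular_real_smul_left (c : ℝ) (α β : D) : B (c • α) β = c • B α β := by
  rw [triangular_swap hs hB hc, triangular_real_smul_right hs hB hc, triangular_swap hs hB hc α β,
    smul_neg]

include hc in
-- After pairing with Y and replacing s (B β γ) by [s β, s γ], the second-order terms cancel by the
-- representation property of ∇ and the Jacobi identity of A. What remains is ∇_Y of the cyclic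
-- identity equivalent to [P,P]^φ = 0.
theorem triangular_jacobi (hP : A.schoutenTwist e φ P P = 0)
    (hJ : ∀ X Y Z, A.bracket X (A.bracket Y Z) + A.bracket Y (A.bracket Z X)
      + A.bracket Z (A.bracket X Y) = 0)
    (hρ : ∀ X Y f, A.anchor (A.bracket X Y) f
      = A.anchor X (A.anchor Y f) - A.anchor Y (A.anchor X f))
    (hφ : ∀ X Y, e (A.bracket X Y) φ = A.anchor X (e Y φ) - A.anchor Y (e X φ)) (α β γ : D) :
    B α (B β γ) + B β (B γ α) + B γ (B α β) = 0 := by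
  refine hc _ _ fun Y => ?_
  have hsB := sharp_bracket hs hB hP
  have hJ' : ∀ X Y Z, A.bracket (A.bracket X Y) Z
      = A.bracket X (A.bracket Y Z) - A.bracket Y (A.bracket X Z) := fun X Y Z => by
    have := hJ X Y Z
    rw [A.bracket_swap (A.bracket X Y) Z, A.bracket_swap X Z, map_neg, sub_neg_eq_add,
      neg_eq_iff_add_eq_zero, ← this]
    abel
  have hn := A.nabla_bracket e hρ hφ
  -- The condition [P,P]^φ = 0 in scalar form, recovered from `sharp_bracket` by evaluating B α β on
  -- s γ.
  have hS : e (A.bracket (s α) (s β)) γ + e (A.bracket (s β) (s γ)) α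
      + e (A.bracket (s γ) (s α)) β = A.nabla e φ (s α) (e (s β) γ)
        + A.nabla e φ (s β) (e (s γ) α) + A.nabla e φ (s γ) (e (s α) β) := by
    have h := hB α β (s γ)
    rw [triangularValue, ← neg_eq_iff_eq_neg.2 (sharp_skew hs (B α β) γ), hsB,
      sharp_skew hs γ β, A.bracket_swap (s α) (s γ)] at h
    simp only [map_neg, LinearMap.neg_apply] at h
    linear_combination -h
  have hSY := congrArg (A.nabla e φ Y) hS
  simp only [map_add] at hSY
  rw [map_zero, map_add, map_add, hB, hB, hB]
  simp only [triangularValue, hsB]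
  rw [sharp_skew hs α (B β γ), sharp_skew hs β (B γ α), sharp_skew hs γ (B α β)]
  simp only [hsB, hB, triangularValue, hn, hJ', map_sub, map_neg, LinearMap.sub_apply]
  linear_combination hSY

end Bracket

section DualStructure
variable {A' : AnchoredBracket R D}
  (hb : ∀ α β Y, e Y (A'.bracket α β) = A.triangularValue e φ s α β Y)
  (ha : ∀ α f, A'.anchor α f = A.anchor (s α) f)
include hb ha

theorem isCocycle_neg_sharp (hP : A.schoutenTwist e φ P P = 0)
    (hφ : ∀ X Y, e (A.bracket X Y) φ = A.anchor X (e Y φ) - A.anchor Y (e X φ)) :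
    A'.IsCocycle (e (-s φ)) := by
  intro α β
  -- By skewness X₀ is φ composed with s.
  have h : ∀ γ, e (-s φ) γ = e (s γ) φ := fun γ => by
    rw [map_neg, LinearMap.neg_apply, sharp_skew hs φ γ, neg_neg]
  rw [h, h, h, ha, ha, sharp_bracket hs (B := fun α β => A'.bracket α β) hb hP, hφ]

/-- `d_*^{X₀} X = -[X, P]^φ`. -/
theorem dTwist_dual_ofDual (X : Γ) (ℓ : D → D)
    (hℓ : ∀ α Y, e Y (ℓ α) = A.anchor X (e Y α) - e (A.bracket X Y) α) (α β : D) :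
    A'.dTwist (e (-s φ)) (Form.ofDual (e X)) ![α, β] =
      -(A.anchor X (P ![α, β]) - P ![ℓ α, β] - P ![α, ℓ β]) + e X φ * P ![α, β] := by
  have h : ∀ γ, e (-s φ) γ = e (s γ) φ := fun γ => by
    rw [map_neg, LinearMap.neg_apply, sharp_skew hs φ γ, neg_neg]
  rw [dTwist_ofDual, h, h, ha, ha, hb, ← hs, ← hs, ← hs, sharp_skew hs (ℓ α), hℓ, hℓ,
    A.bracket_swap X (s α), A.bracket_swap X (s β), sharp_skew hs β α]
  simp only [triangularValue, nabla_apply, map_neg, LinearMap.neg_apply]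
  ring

/-- With D_X = [X,·]^φ on bivectors, the sides are −D_{[X,Y]}P and D_Y D_X P − D_X D_Y P. They agree
because Lie derivatives represent the bracket and φ is a cocycle. -/
theorem dTwist_dual_bracket
    (hc : ∀ α β : D, (∀ Y, e Y α = e Y β) → α = β)
    (hc' : ∀ ξ : Module.Dual R Γ, ∃ α, ∀ Y, e Y α = ξ Y)
    (hJ : ∀ X Y Z, A.bracket X (A.bracket Y Z) + A.bracket Y (A.bracket Z X)
      + A.bracket Z (A.bracket X Y) = 0)
    (hρ : ∀ X Y f, A.anchor (A.bracket X Y) f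
      = A.anchor X (A.anchor Y f) - A.anchor Y (A.anchor X f))
    (hφ : ∀ X Y, e (A.bracket X Y) φ = A.anchor X (e Y φ) - A.anchor Y (e X φ)) (X Y : Γ) :
    (A'.dTwist (e (-s φ)) (Form.ofDual (e (A.bracket X Y))) : Form R D 2) =
      (A.schoutenTwist e φ (A'.dTwist (e (-s φ)) (Form.ofDual (e X))) (Form.ofDual (e Y)) :
        Form R D 2) +
      (A.schoutenTwist e φ (Form.ofDual (e X)) (A'.dTwist (e (-s φ)) (Form.ofDual (e Y))) :
        Form R D 2) := by
  choose ℓ hℓ using A.exists_lieDual (e := e) hc'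
  -- L_{[X,Y]} is the commutator of L_X and L_Y on covectors, by the Jacobi identity and the
  -- compatibility of the anchor.
  have hbr : ∀ α, ℓ (A.bracket X Y) α = ℓ X (ℓ Y α) - ℓ Y (ℓ X α) := fun α => by
    refine hc _ _ fun Z => ?_
    have hJ' : A.bracket (A.bracket X Y) Z
        = A.bracket X (A.bracket Y Z) - A.bracket Y (A.bracket X Z) := by
      have := hJ X Y Z
      rw [A.bracket_swap (A.bracket X Y) Z, A.bracket_swap X Z, map_neg, sub_neg_eq_add,
        neg_eq_iff_add_eq_zero, ← this]
      abel
    simp only [map_sub, hℓ, hJ', hρ, LinearMap.sub_apply]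
    ring
  have hd := fun Z => dTwist_dual_ofDual hs hb ha Z (ℓ Z) (hℓ Z)
  ext v
  obtain ⟨x, y, rfl⟩ : ∃ x y, v = ![x, y] :=
    ⟨v 0, v 1, by funext i; fin_cases i <;> rfl⟩
  rw [AlternatingMap.add_apply, hd, hbr, hbr]
  have h1 := A.schoutenTwist_two_ofDual_lie e φ (A'.dTwist (e (-s φ)) (Form.ofDual (e X))) Y
    (ℓ Y) (hℓ Y) x y
  have h2 := (A.schoutenTwist_ofDual_left e φ X (ℓ X) (hℓ X) (q := 2) rfl
    (A'.dTwist (e (-s φ)) (Form.ofDual (e Y))) ![x, y])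
  have h3 : ∀ Q : Form R D 2, ∑ i, Q (Function.update ![x, y] i (ℓ X (![x, y] i)))
      = Q ![ℓ X x, y] + Q ![x, ℓ X y] := fun Q => by
    rw [Fin.sum_univ_two, Form.apply_two Q, Form.apply_two Q (Function.update _ 1 _)]
    simp
  rw [h3] at h2
  simp only [hd] at h1 h2
  refine Eq.trans ?_ (congrArg₂ (· + ·) h1 h2).symm
  simp only [hd, hφ, P.map_pair_sub_left, P.map_pair_sub_right, map_add, map_sub, map_neg, hρ,
    Derivation.leibniz, smul_eq_mul]
  norm_num
  ring

/-- `L_{*φ}^{X₀} Q + [X₀, Q]^φ = 0`. -/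
theorem lieTwist_dual_add
    (hφ : ∀ X Y, e (A.bracket X Y) φ = A.anchor X (e Y φ) - A.anchor Y (e X φ)) {p : ℕ}
    (h : 1 + p - 1 = p) (Q : Form R D p) :
    A'.lieTwist (e (-s φ)) φ Q
      + Form.castDeg h (A.schoutenTwist e φ (Form.ofDual (e (-s φ))) Q) = 0 := by
  have h0 : e (s φ) φ = 0 := by
    rw [hs]
    exact P.map_eq_zero_of_eq ![φ, φ] (i := 0) (j := 1) rfl (by simp)
  -- So L_{X₀}α = −[φ,α]_*: the cocycle condition rewrites φ([s α, Y]), whose terms cancel against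
  -- ∇_Y P(φ,α), while P(φ,φ) = 0 removes the zero-order term.
  have hℓ : ∀ α Y, e Y (-A'.bracket φ α)
      = A.anchor (-s φ) (e Y α) - e (A.bracket (-s φ) Y) α := fun α Y => by
    have := hφ (s α) Y
    simp only [map_neg, hb, triangularValue, nabla_apply, h0, LinearMap.neg_apply,
      Derivation.neg_apply, sharp_skew hs φ α, this]
    ring
  ext v
  rw [AlternatingMap.add_apply, lieTwist_apply,
    A.schoutenTwist_ofDual_left e φ _ _ hℓ h, ha]
  simp [h0]

end DualStructure
end AnchoredBracket
end Triangular

/-! ### Tensoriality: module maps on sections come from smooth bundle maps. -/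

section BundleMaps
variable {E : Type*} [NormedAddCommGroup E] [NormedSpace ℝ E]
  {M : Type*} [TopologicalSpace M] [ChartedSpace E M] [IsManifold 𝓘(ℝ, E) ∞ M]
  {F : Type*} [NormedAddCommGroup F] [NormedSpace ℝ F] {V : M → Type*}
  [TopologicalSpace (TotalSpace F V)] [∀ x, TopologicalSpace (V x)] [FiberBundle F V]
  [∀ x, AddCommGroup (V x)] [∀ x, Module ℝ (V x)] [VectorBundle ℝ F V]

/-- In local trivializations this is the bounded bilinear map `smulRight` applied to the smooth
coordinates of σ and w. -/
theorem contMDiffAt_smulRight (σ : SmoothSection E M (F →L[ℝ] ℝ) (DualBundle M V))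
    (w : VectorField E M) (x : M) :
    ContMDiffAt 𝓘(ℝ, E) (𝓘(ℝ, E).prod 𝓘(ℝ, F →L[ℝ] E)) ∞
      (fun y => (⟨y, ContinuousLinearMap.smulRight (M₁ := V y) (σ y : V y →L[ℝ] ℝ) (w y)⟩ :
        TotalSpace (F →L[ℝ] E) fun y => V y →L[ℝ] TangentSpace 𝓘(ℝ, E) y)) x := by
  rw [contMDiffAt_hom_bundle]
  refine ⟨contMDiffAt_id, ?_⟩
  have h1 := ((contMDiffAt_hom_bundle _).1 (σ.contMDiff x)).2
  have h2 := (contMDiffAt_totalSpace.1 (w.contMDiff x)).2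
  have h3 := (isBoundedBilinearMap_smulRight (𝕜 := ℝ) (E := F)
    (F := E)).contDiff.contDiffAt.contMDiffAt.comp x (h1.prodMk_space h2)
  refine h3.congr_of_eventuallyEq ?_
  filter_upwards [(trivializationAt E (TangentSpace 𝓘(ℝ, E)) x).open_baseSet.mem_nhds
    (FiberBundle.mem_baseSet_trivializationAt' x)] with y hy
  ext v
  change (trivializationAt E (TangentSpace 𝓘(ℝ, E)) x).continuousLinearMapAt ℝ y
      ((σ y : V y →L[ℝ] ℝ) ((trivializationAt F V x).symmL ℝ y v) • w y)
    = ((trivializationAt ℝ (Bundle.Trivial M ℝ) x).continuousLinearMapAt ℝ y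
        (σ y ((trivializationAt F V x).symmL ℝ y v)))
      • ((trivializationAt E (TangentSpace 𝓘(ℝ, E)) x) ⟨y, w y⟩).2
  rw [map_smul, Bundle.Trivialization.continuousLinearMapAt_apply,
    Bundle.Trivialization.coe_linearMapAt_of_mem _ hy,
    Bundle.Trivialization.continuousLinearMapAt_apply,
    Bundle.Trivialization.coe_linearMapAt_of_mem _ (by simp)]
  rfl

variable [FiniteDimensional ℝ E] [T2Space M] [ContMDiffVectorBundle ∞ F V 𝓘(ℝ, E)]

theorem exists_section_eq (x : M) (v : V x) : ∃ X : SmoothSection E M F V, X x = v := by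
  obtain ⟨X, hX⟩ := exists_constant_section (E := E) (F := F) (V := V) x
    (trivializationAt F V x ⟨x, v⟩).2
  refine ⟨X, ?_⟩
  rw [hX.self_of_nhds]
  exact (trivializationAt F V x).symm_apply_apply_mk
    (FiberBundle.mem_baseSet_trivializationAt' x) v

variable [FiniteDimensional ℝ F]

/-- X minus its frame expansion vanishes at y, and a module functional depends only on the value at
y. -/
theorem dual_frame_eval (ξ : SmoothSection E M F V →ₗ[SmoothFun E M] SmoothFun E M) {y : M}
    {σ : Fin (Module.finrank ℝ F) → SmoothSection E M (F →L[ℝ] ℝ) (DualBundle M V)}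
    {s : Fin (Module.finrank ℝ F) → SmoothSection E M F V}
    (h : ∀ v : V y, v = ∑ i, σ i y v • s i y) (X : SmoothSection E M F V) :
    ξ X y = ∑ i, σ i y (X y) * ξ (s i) y := by
  have h1 : (X - ∑ i, pairing (σ i) X • s i) y = 0 := by
    change X y - (∑ i, pairing (σ i) X • s i : SmoothSection E M F V) y = 0
    rw [sum_smul_section_apply, sub_eq_zero]
    exact h (X y)
  have h3 := dual_pointwise ξ h1
  rw [map_sub, map_sum] at h3
  have h4 : ξ X y = (∑ i, ξ (pairing (σ i) X • s i) : SmoothFun E M) y := sub_eq_zero.1 h3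
  rw [h4]
  have := map_sum (ContMDiffMap.evalRingHom (I := 𝓘(ℝ, E)) (I' := 𝓘(ℝ, ℝ)) (n := ∞) y)
    (fun i => ξ (pairing (σ i) X • s i)) Finset.univ
  simp only [map_smul] at this ⊢
  exact this

theorem covectorDual_injective {α β : SmoothSection E M (F →L[ℝ] ℝ) (DualBundle M V)}
    (h : ∀ X : SmoothSection E M F V, dualEquiv X α = dualEquiv X β) : α = β := by
  ext x v
  obtain ⟨X, rfl⟩ := exists_section_eq (E := E) (F := F) x v
  exact congrArg (fun f : SmoothFun E M => f x) (h X)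

theorem exists_covector (ξ : SmoothSection E M F V →ₗ[SmoothFun E M] SmoothFun E M) :
    ∃ α : SmoothSection E M (F →L[ℝ] ℝ) (DualBundle M V), ∀ X, dualEquiv X α = ξ X := by
  choose σ s h using exists_frame (E := E) (M := M) (F := F) (V := V)
  have ha : ∀ x y, (∀ v : V y, v = ∑ i, σ x i y v • s x i y) → ∀ X : SmoothSection E M F V,
      (∑ i, ξ (s x i) • σ x i : SmoothSection E M (F →L[ℝ] ℝ) (DualBundle M V)) y (X y)
        = ξ X y := by
    intro x y hy X
    rw [dual_frame_eval ξ hy X, sum_smul_section_apply, sum_apply]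
    exact Finset.sum_congr rfl fun i _ => mul_comm _ _
  -- The frame varies with the point. Near x the values agree with those of the single frame chosen
  -- at x, as both represent ξ; hence smoothness.
  refine ⟨⟨fun x => (∑ i, ξ (s x i) • σ x i :
    SmoothSection E M (F →L[ℝ] ℝ) (DualBundle M V)) x, fun x => ?_⟩, fun X => ?_⟩
  · refine ((∑ i, ξ (s x i) • σ x i :
      SmoothSection E M (F →L[ℝ] ℝ) (DualBundle M V)).contMDiff x).congr_of_eventuallyEq ?_
    filter_upwards [h x] with y hy
    congr 1
    ext v
    obtain ⟨X, rfl⟩ := exists_section_eq (E := E) (F := F) y v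
    rw [ha x y hy, ha y y (h y).self_of_nhds]
  · ext x
    exact ha x x (h x).self_of_nhds X

/-- A `C^∞(M)`-linear map `Γ(V) → 𝔛(M)` is induced by a smooth bundle map `V → TM`. -/
theorem exists_bundleMap (T : SmoothSection E M F V →ₗ[SmoothFun E M] VectorField E M) :
    ∃ a : SmoothSection E M (F →L[ℝ] E) (fun x => V x →L[ℝ] TangentSpace 𝓘(ℝ, E) x),
      ∀ X x, a x (X x) = T X x := by
  choose σ s h using exists_frame (E := E) (M := M) (F := F) (V := V)
  let a : ∀ x y : M, V y →L[ℝ] TangentSpace 𝓘(ℝ, E) y := fun x y =>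
    ∑ i, ContinuousLinearMap.smulRight (M₁ := V y) (σ x i y : V y →L[ℝ] ℝ) (T (s x i) y)
  have ha : ∀ x y, (∀ v : V y, v = ∑ i, σ x i y v • s x i y) → ∀ X : SmoothSection E M F V,
      a x y (X y) = T X y := by
    intro x y hy X
    -- Testing against covector fields reduces the claim to scalar functionals.
    refine eq_of_sections (E := E) (F := E) (V := fun x : M => TangentSpace 𝓘(ℝ, E) x) fun α => ?_
    have h1 := dual_frame_eval ((dualEquiv (E := E) (M := M) (F := E)
      (V := fun x : M => TangentSpace 𝓘(ℝ, E) x)).toLinearMap.flip α ∘ₗ T) hy X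
    refine Eq.trans ?_ h1.symm
    simp only [a]
    rw [sum_apply, map_sum]
    refine Finset.sum_congr rfl fun i _ => ?_
    exact map_smul (α y) _ _
  refine ⟨⟨fun x => a x x, fun x => ?_⟩, fun X x => ha x x (h x).self_of_nhds X⟩
  have hs : ContMDiffAt 𝓘(ℝ, E) (𝓘(ℝ, E).prod 𝓘(ℝ, F →L[ℝ] E)) ∞
      (fun y => (⟨y, a x y⟩ :
        TotalSpace (F →L[ℝ] E) fun y => V y →L[ℝ] TangentSpace 𝓘(ℝ, E) y)) x :=
    ContMDiffAt.sum_section fun i _ => contMDiffAt_smulRight (σ x i) (T (s x i)) x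
  refine hs.congr_of_eventuallyEq ?_
  filter_upwards [h x] with y hy
  congr 1
  ext v
  obtain ⟨X, rfl⟩ := exists_section_eq (E := E) (F := F) y v
  rw [ha x y hy, ha y y (h y).self_of_nhds]

end BundleMaps

/-! ### Transfer to Lie algebroids on bundles: existence, uniqueness and compatibility. -/

section Triangular
variable {E : Type*} [NormedAddCommGroup E] [NormedSpace ℝ E] [FiniteDimensional ℝ E]
  {M : Type*} [TopologicalSpace M] [T2Space M] [ChartedSpace E M] [IsManifold 𝓘(ℝ, E) ∞ M]
  {F : Type*} [NormedAddCommGroup F] [NormedSpace ℝ F] [FiniteDimensional ℝ F] {V : M → Type*}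
  [TopologicalSpace (TotalSpace F V)] [∀ x, TopologicalSpace (V x)] [FiberBundle F V]
  [∀ x, AddCommGroup (V x)] [∀ x, Module ℝ (V x)] [VectorBundle ℝ F V]
  [ContMDiffVectorBundle ∞ F V 𝓘(ℝ, E)]

theorem smoothFun_eq_zero_of_smul [Nontrivial F] (g : SmoothFun E M)
    (h : ∀ Z : SmoothSection E M F V, g • Z = 0) : g = 0 := by
  ext x
  obtain ⟨w, hw⟩ := exists_ne (0 : F)
  let L := VectorBundle.continuousLinearEquivAt ℝ F V x
  obtain ⟨Z, hZ⟩ := exists_section_eq (E := E) (F := F) x (L.symm w)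
  have h1 : g x • Z x = 0 := congrArg (fun s : SmoothSection E M F V => s x) (h Z)
  rw [hZ] at h1
  rcases smul_eq_zero.1 (show g x • w = 0 by simpa using congrArg L h1) with h2 | h2
  · exact h2
  · exact absurd h2 hw

theorem smoothSection_subsingleton [Subsingleton F] : Subsingleton (SmoothSection E M F V) :=
  ⟨fun _ _ => ContMDiffSection.ext fun x =>
    (VectorBundle.continuousLinearEquivAt ℝ F V x).injective (Subsingleton.elim _ _)⟩

namespace LieAlgebroid
variable (A : LieAlgebroid E M F V)

/-- Derived from the Jacobi and Leibniz identities rather than from the bracket of vector fields: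
expanding the Jacobi identity on f • Z leaves the defect of the anchor at f, times Z. Rank zero is
separate, since sections then detect no function. -/
theorem sections_anchor_bracket (X Y : SmoothSection E M F V) (f : SmoothFun E M) :
    A.sections.anchor (A.sections.bracket X Y) f
      = A.sections.anchor X (A.sections.anchor Y f)
        - A.sections.anchor Y (A.sections.anchor X f) := by
  rcases subsingleton_or_nontrivial F with hF | hF
  · have := smoothSection_subsingleton (E := E) (F := F) (V := V)
    rw [Subsingleton.elim (A.sections.bracket X Y) 0, Subsingleton.elim X 0,
      Subsingleton.elim Y 0]
    simp
  rw [← sub_eq_zero]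
  refine smoothFun_eq_zero_of_smul (F := F) (V := V) _ fun Z => ?_
  have hJ : ∀ W, A.sections.bracket (A.sections.bracket X Y) W
      = A.sections.bracket X (A.sections.bracket Y W)
        - A.sections.bracket Y (A.sections.bracket X W) := fun W => by
    have h : A.sections.bracket X (A.sections.bracket Y W)
      + A.sections.bracket Y (A.sections.bracket W X)
      + A.sections.bracket W (A.sections.bracket X Y) = 0 := A.jacobi X Y W
    rw [A.sections.bracket_swap (A.sections.bracket X Y) W, A.sections.bracket_swap X W, map_neg,
      sub_neg_eq_add, neg_eq_iff_add_eq_zero, ← h]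
    abel
  have h := hJ (f • Z)
  simp only [A.sections.leibniz, map_add, hJ Z] at h
  rw [← sub_eq_zero] at h
  rw [← h]
  module

variable {A} {φ₀ : SmoothSection E M (F →L[ℝ] ℝ) (DualBundle M V)} {P : Multisection E M F V 2}
  {A' : LieAlgebroid E M (F →L[ℝ] ℝ) (DualBundle M V)}

/-- Converts the definition by Lie derivatives into the pairing formula on which the algebra rests.
-/
theorem triangular_bracket_iff
    (α β γ : SmoothSection E M (F →L[ℝ] ℝ) (DualBundle M V)) :
    Form.ofDual (covectorDual γ) =
      A.sections.lieTwist (covectorDual φ₀) (sharp P α) (Form.ofDual (covectorDual β))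
      - A.sections.lieTwist (covectorDual φ₀) (sharp P β) (Form.ofDual (covectorDual α))
      - A.sections.dTwist (covectorDual φ₀) (Form.ofFun (P ![α, β])) ↔
    ∀ Y, dualEquiv Y γ = A.sections.triangularValue dualEquiv φ₀ (sharp P) α β Y := by
  have hv : ∀ v : Fin 1 → SmoothSection E M F V,
      (A.sections.lieTwist (covectorDual φ₀) (sharp P α) (Form.ofDual (covectorDual β))
      - A.sections.lieTwist (covectorDual φ₀) (sharp P β) (Form.ofDual (covectorDual α))
      - A.sections.dTwist (covectorDual φ₀) (Form.ofFun (P ![α, β])) :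
        Form (SmoothFun E M) (SmoothSection E M F V) 1) v
      = A.sections.triangularValue dualEquiv φ₀ (sharp P) α β (v 0) := fun v => by
    rw [AlternatingMap.sub_apply, AlternatingMap.sub_apply, AnchoredBracket.lieTwist_ofDual,
      AnchoredBracket.lieTwist_ofDual, AnchoredBracket.dTwist_zero_apply]
    rw [AnchoredBracket.triangularValue, dualEquiv_apply (sharp P α) β, pairing_sharp]
    rfl
  constructor
  · intro h Y
    refine Eq.trans ?_ (hv ![Y])
    rw [← h]
    rfl
  · intro h
    ext1 v
    rw [hv, ← h]
    rfl

theorem dualEquiv_sharp (α β : SmoothSection E M (F →L[ℝ] ℝ) (DualBundle M V)) :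
    dualEquiv (sharp P α) β = P ![α, β] := by
  rw [dualEquiv_apply, pairing_sharp]

theorem exists_isTriangularDual (hφ₀ : A.IsCocycle φ₀) (hP : A.schoutenTwist φ₀ P P = 0) :
    ∃ A' : LieAlgebroid E M (F →L[ℝ] ℝ) (DualBundle M V), A.IsTriangularDual φ₀ P A' := by
  have hs := dualEquiv_sharp (P := P)
  have hex : ∀ α β, ∃ γ, ∀ Y, dualEquiv Y γ
      = A.sections.triangularValue dualEquiv φ₀ (sharp P) α β Y := fun α β => by
    -- The right-hand side of the bracket formula is already a 1-form, so its linearity in Y is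
    -- automatic and it is represented by a section.
    obtain ⟨γ, hγ⟩ := exists_covector ((AlternatingMap.ofSubsingleton (SmoothFun E M)
        (SmoothSection E M F V) (SmoothFun E M) (0 : Fin 1)).symm
      (A.sections.lieTwist (covectorDual φ₀) (sharp P α) (Form.ofDual (covectorDual β))
      - A.sections.lieTwist (covectorDual φ₀) (sharp P β) (Form.ofDual (covectorDual α))
      - A.sections.dTwist (covectorDual φ₀) (Form.ofFun (P ![α, β]))))
    refine ⟨γ, (triangular_bracket_iff α β γ).1 ?_⟩
    have h : covectorDual γ = _ := LinearMap.ext hγ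
    rw [h]
    exact Equiv.apply_symm_apply (AlternatingMap.ofSubsingleton (SmoothFun E M)
        (SmoothSection E M F V) (SmoothFun E M) (0 : Fin 1)) _
  choose B hB using hex
  have hc : ∀ α β : SmoothSection E M (F →L[ℝ] ℝ) (DualBundle M V),
    (∀ Y : SmoothSection E M F V, dualEquiv Y α = dualEquiv Y β) → α = β :=
    fun α β => covectorDual_injective
  obtain ⟨a, ha⟩ := exists_bundleMap (E := E) (M := M) (F := F →L[ℝ] ℝ) (V := DualBundle M V)
    { toFun := fun α => A.anchorField (sharp P α)
      map_add' := fun α β => ContMDiffSection.ext fun x => by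
        rw [AnchoredBracket.sharp_add hs]
        exact map_add (A.anchor x) (sharp P α x) (sharp P β x)
      map_smul' := fun f α => ContMDiffSection.ext fun x => by
        rw [AnchoredBracket.sharp_smul hs]
        exact map_smul (A.anchor x) (f x) (sharp P α x) }
  replace ha : ∀ (α : SmoothSection E M (F →L[ℝ] ℝ) (DualBundle M V)) (x : M),
    a x (α x) = A.anchor x (sharp P α x) := ha
  refine ⟨
    { anchor := a
      bracket := LinearMap.mk₂ ℝ B (AnchoredBracket.triangular_add_left hs hB hc)
        (AnchoredBracket.triangular_real_smul_left hs hB hc)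
        (AnchoredBracket.triangular_add_right hs hB hc)
        (AnchoredBracket.triangular_real_smul_right hs hB hc)
      bracket_self := AnchoredBracket.triangular_self hs hB hc
      jacobi := AnchoredBracket.triangular_jacobi hs hB hc hP A.jacobi
        A.sections_anchor_bracket hφ₀
      anchor_bracket := fun α β x => ?_
      leibniz := fun α β f => ?_ }, fun α β => ?_, ha⟩
  -- P♯ preserves brackets, so the statement for vector fields is inherited from the anchor of A.
  · rw [LinearMap.mk₂_apply, ha, AnchoredBracket.sharp_bracket hs hB hP]
    simp only [ha]
    exact A.anchor_bracket (sharp P α) (sharp P β) x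
  · refine (AnchoredBracket.triangular_smul_right hs hB hc f α β).trans ?_
    congr 2
    ext x
    exact congrArg (mfderiv 𝓘(ℝ, E) 𝓘(ℝ, ℝ) f x) (ha α x).symm
  · exact (triangular_bracket_iff α β _).2 (hB α β)

theorem IsTriangularDual.unique {A'' : LieAlgebroid E M (F →L[ℝ] ℝ) (DualBundle M V)}
    (h' : A.IsTriangularDual φ₀ P A') (h'' : A.IsTriangularDual φ₀ P A'') : A' = A'' := by
  have hb : A'.bracket = A''.bracket := LinearMap.ext₂ fun α β => covectorDual_injective fun Y => by
    rw [(triangular_bracket_iff α β _).1 (h'.bracket_eq α β),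
      (triangular_bracket_iff α β _).1 (h''.bracket_eq α β)]
  have ha : A'.anchor = A''.anchor := ContMDiffSection.ext fun x => by
    ext ξ
    -- Every covector at x extends to a global section, so values on sections determine the anchor.
    obtain ⟨α, rfl⟩ := exists_section_eq (E := E) (F := F →L[ℝ] ℝ) (V := DualBundle M V) x ξ
    rw [h'.anchor_eq, h''.anchor_eq]
  cases A'
  cases A''
  cases hb
  cases ha
  rfl

theorem IsTriangularDual.isGeneralizedBialgebroid (h : A.IsTriangularDual φ₀ P A')
    (hφ₀ : A.IsCocycle φ₀) (hP : A.schoutenTwist φ₀ P P = 0) :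
    A.IsGeneralizedBialgebroid φ₀ A' (-sharp P φ₀) := by
  have hs := dualEquiv_sharp (P := P)
  have hb : ∀ α β Y, dualEquiv Y (A'.sections.bracket α β)
      = A.sections.triangularValue dualEquiv φ₀ (sharp P) α β Y := fun α β =>
    (triangular_bracket_iff α β _).1 (h.bracket_eq α β)
  have ha : ∀ α f, A'.sections.anchor α f = A.sections.anchor (sharp P α) f := fun α f => by
    ext x
    exact congrArg (mfderiv 𝓘(ℝ, E) 𝓘(ℝ, ℝ) f x) (h.anchor_eq α x)
  have h1 : A'.sections.IsCocycle (dualEquiv (-sharp P φ₀)) :=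
    AnchoredBracket.isCocycle_neg_sharp hs hb ha hP hφ₀
  have h2 := AnchoredBracket.dTwist_dual_bracket hs hb ha
    (fun α β => covectorDual_injective) exists_covector A.jacobi A.sections_anchor_bracket hφ₀
  have h3 : ∀ (p : ℕ) (Q : Multisection E M F V p),
      A'.sections.lieTwist (dualEquiv (-sharp P φ₀)) φ₀ Q
        + Form.castDeg (by omega) (A.sections.schoutenTwist dualEquiv φ₀
          (Form.ofDual (dualEquiv (-sharp P φ₀))) Q) = 0 := fun p Q =>
    AnchoredBracket.lieTwist_dual_add hs hb ha hφ₀ _ Q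
  exact ⟨hφ₀, h1, h2, h3⟩

end LieAlgebroid
end Triangular

end

end GLB

theorem theorem5p4
    {E : Type*} [NormedAddCommGroup E] [NormedSpace ℝ E] [FiniteDimensional ℝ E]
    {M : Type*} [TopologicalSpace M] [T2Space M] [SecondCountableTopology M]
    [ChartedSpace E M] [IsManifold 𝓘(ℝ, E) ∞ M]
    {F : Type*} [NormedAddCommGroup F] [NormedSpace ℝ F] [FiniteDimensional ℝ F]
    {V : M → Type*} [TopologicalSpace (TotalSpace F V)] [∀ x, TopologicalSpace (V x)]
    [FiberBundle F V] [∀ x, AddCommGroup (V x)] [∀ x, Module ℝ (V x)] [VectorBundle ℝ F V]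
    [ContMDiffVectorBundle ∞ F V 𝓘(ℝ, E)]
    (A : GLB.LieAlgebroid E M F V)
    (φ₀ : GLB.SmoothSection E M (F →L[ℝ] ℝ) (GLB.DualBundle M V))
    (hφ₀ : A.IsCocycle φ₀)
    (P : GLB.Multisection E M F V 2)
    (hP : A.schoutenTwist φ₀ P P = 0) :
    (∃! A' : GLB.LieAlgebroid E M (F →L[ℝ] ℝ) (GLB.DualBundle M V),
      A.IsTriangularDual φ₀ P A') ∧
    ∀ A' : GLB.LieAlgebroid E M (F →L[ℝ] ℝ) (GLB.DualBundle M V),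
      A.IsTriangularDual φ₀ P A' →
        A.IsGeneralizedBialgebroid φ₀ A' (-GLB.sharp P φ₀) := by
  obtain ⟨A', hA'⟩ := GLB.LieAlgebroid.exists_isTriangularDual hφ₀ hP
  exact ⟨⟨A', hA', fun _ h => h.unique hA'⟩, fun _ h => h.isGeneralizedBialgebroid hφ₀ hP⟩
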